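/- Let $n\ge 1$ and $0<\alpha\le 1$. There is $\delta_0\in(0,1)$ depending only on $n$ and $\alpha$ such that for all real $\lambda,\Lambda,M,\kappa,K,\rho$ with $\lambda,\kappa,\rho>0$ there is a constant $C>0$, depending only on $n,\alpha,\lambda,\Lambda,M,\kappa,K,\rho$, with the following property. Write points of $\mathbb{R}^n$ as $x=(x',x_n)$, $x'\in\mathbb{R}^{n-1}$, and let $e_n=(0,1)$. Let $\Omega\subset\mathbb{R}^n_+=\{x_n>0\}$ be an open convex set with $0\in\partial\Omega$ which is uniformly convex at $0$ with modulus $\kappa$, i.e. $x_n\ge\kappa|x|^2$ for all $x\in\Omega$. Let $u:\overline\Omega\to\mathbb{R}$ be a convex continuous solution, in the sense of Alexandrov, of $$\det D^2u=f\ \text{ in }\Omega,\qquad u=\varphi\ \text{ on }\partial\Omega,$$ where $f$ is measurable with $\lambda\le f\le\Lambda$ a.e. in $\Omega$, and $\|\varphi\|_{L^\infty(\partial\Omega)}\le K$ (that is, $|\varphi|\le K$ on $\partial\Omega$). Suppose that for some polynomials $p,q$ of degree at most $2$ on $\mathbb{R}^{n-1}$ with $$M\ge\max\{|\nabla p(0)|,\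 \|D^2p\|,\ \|D^2q\|\}$$ we have, for all $x\in\partial\Omega$ with $|x|<\rho$, $$|x_n-q(x')|\le M|x'|^{2+\alpha},\qquad |\varphi(x)-p(x')|\le M|x'|^{2+\alpha}.$$ Call a vector $g$ a boundary gradient $\nabla u(0)$ if $u(x)\ge u(0)+g\cdot x$ on $\overline\Omega$, while for every $\varepsilon>0$ the inequality $u(x)\ge u(0)+(g+\varepsilon e_n)\cdot x$ fails somewhere on $\overline\Omega$. Then $\nabla u(0)$ exists, and for every such $\nabla u(0)$ $$u(x)-u(0)-\nabla u(0)\cdot x\le C|x|^{1+\delta_0}\qquad\text{for all }x\in\overline\Omega .$$ In particular $u\in C^{1,\delta_0}(0)$: there is a polynomial $P$ of degree at most $1$ with $u(x)=P(x)+O(|x|^{1+\delta_0})$ as $x\to 0$ in $\overline\Omega$. -/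

import Mathlib

open MeasureTheory Set Filter Topology Asymptotics

namespace BoundaryMA

/-- The Euclidean space `ℝᵏ`. -/
abbrev E (k : ℕ) : Type := EuclideanSpace ℝ (Fin k)

/-- The tangential part `x' = (x₁, …, x_{n-1})` of a point `x = (x', x_n)` of `ℝⁿ`, `n = d + 1`. -/
def tang {d : ℕ} (x : E (d + 1)) : E d := WithLp.toLp 2 (fun i : Fin d => x i.castSucc)

/-- The last coordinate `x_n` of a point `x = (x', x_n)` of `ℝⁿ`, `n = d + 1`. -/
def lastCoord {d : ℕ} (x : E (d + 1)) : ℝ := x (Fin.last d)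

/-- The unit vector `e_n = (0, 1)` of `ℝⁿ`, `n = d + 1`. -/
noncomputable def eLast (d : ℕ) : E (d + 1) := EuclideanSpace.single (Fin.last d) (1 : ℝ)

/-- The subdifferential of `u` at `x`, relative to the set `Ω`: all slopes of affine functions
that support the graph of `u` over `Ω` from below at `x`. -/
def subdiff {k : ℕ} (Ω : Set (E k)) (u : E k → ℝ) (x : E k) : Set (E k) :=
  {g | ∀ y ∈ Ω, u x + inner ℝ g (y - x) ≤ u y}

/-- `det D²u = f` in `Ω` in the sense of Alexandrov: the Monge–Ampère measure
`S ↦ |∂u(S)|` of `u` is `f dx` on the Borel subsets of `Ω`. -/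
def IsAlexandrovSolution {k : ℕ} (Ω : Set (E k)) (u f : E k → ℝ) : Prop :=
  ∀ S ⊆ Ω, MeasurableSet S →
    volume (⋃ x ∈ S, subdiff Ω u x) = ∫⁻ x in S, ENNReal.ofReal (f x)

/-- `Ω` is uniformly convex at its boundary point `x₀` with inner unit normal `ν` and modulus `κ`:
`Ω` lies in the closed ball of radius `1 / (2 κ)` that touches the hyperplane
`{x | ⟪ν, x - x₀⟫ = 0}` at `x₀`. -/
def UniformlyConvexAt {k : ℕ} (κ : ℝ) (Ω : Set (E k)) (x₀ ν : E k) : Prop :=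
  ∀ x ∈ Ω, κ * ‖x - x₀‖ ^ 2 ≤ inner ℝ ν (x - x₀)

/-- The quadratic polynomial `c + b · y + (1/2) (A y) · y`; for self-adjoint `A` its gradient at
`0` is `b` and its Hessian is `A`. -/
noncomputable def quadPoly {k : ℕ} (c : ℝ) (b : E k) (A : E k →L[ℝ] E k) (y : E k) : ℝ :=
  c + inner ℝ b y + (1 / 2) * inner ℝ (A y) y

/-- `g` is the gradient `∇u(x₀)` of the convex function `u` on `closure Ω` at a boundary point `x₀`
with inner unit normal `ν`: the affine function `u(x₀) + g · (x - x₀)` supports the graph of `u`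
at `x₀`, but `u(x₀) + (g + ε ν) · (x - x₀)` does not, whatever `ε > 0`. -/
def IsBoundaryGradient {k : ℕ} (Ω : Set (E k)) (u : E k → ℝ) (x₀ ν g : E k) : Prop :=
  g ∈ subdiff (closure Ω) u x₀ ∧ ∀ ε : ℝ, 0 < ε → g + ε • ν ∉ subdiff (closure Ω) u x₀

/-- `u : D → ℝ` is pointwise `C^{m,β}` at `x₀`: there is a polynomial `P` of degree at most `m` such
that `u(x) = P(x) + O(|x - x₀|^{m+β})` as `x → x₀` in `D`. -/
def PointwiseCAt {k : ℕ} (m : ℕ) (β : ℝ) (D : Set (E k)) (u : E k → ℝ) (x₀ : E k) : Prop :=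
  ∃ P : MvPolynomial (Fin k) ℝ, P.totalDegree ≤ m ∧
    (fun x : E k => u x - MvPolynomial.eval (fun i => x i) P)
      =O[𝓝[D] x₀] fun x : E k => ‖x - x₀‖ ^ ((m : ℝ) + β)

end BoundaryMA

open BoundaryMA

/-!
Put `v(x) = u(x) - u(0) - ∇u(0) · x ≥ 0`. The assumptions on `∂Ω` force the tangent cone of `Ω` at
`0` to be the upper half space (`linear_part_eq_zero`), and `Ω` contains a region
`{|x'|² ≤ c x_n, x_n ≤ s₀}` of controlled size (`QuadraticDomain.exists_region`). A quadratic lower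
barrier shows that the normal slope is bounded, hence that `∇u(0)` exists, and the boundary data
determine its tangential part. The maximum principle for convex functions then gives `v ≤ C x_n`.

The main point is that the minimal slope `m(t) = min {v / t : x_n = t}` decays like a power of `t`
(`QuadraticProblem.exists_slope_decay`). On `∂Ω`, `v` equals a quadratic form in `x'` up to
`O(|x'|^(2+α))`. Suppose `m(t) ≥ a`. If `v < (a/4) x_n` at some boundary point lower than `t`, then
by homogeneity of the quadratic part `v < a x_n` at a boundary point of height at least `t`, provided
`a` dominates `t^(α/2)`; by convexity of `v` on the ray from `0` this contradicts `m(t) ≥ a`. So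
`v ≥ (a/4) x_n` on the part of `∂Ω` below height `t`, and uniform convexity allows a barrier with
tangential second derivatives of order `a` and normal second derivative of order `a/t`; its Hessian
determinant exceeds the upper bound of `det D²u` as soon as `a^n` dominates `t`. Comparison
(`quadratic_le_of_le_boundary`) gives `v ≥ (a/16) x_n` on `Ω`, against the maximality of the normal
slope of `∇u(0)`. Hence `m(t) ≤ C t^δ` with `δ = α/(2n)`.

For `|x| = r` small, take a point realizing this bound at height `r^(1/2)` and move down the segment
to `0` until the height of `x` is reached. The point found there has small `v`, and `x` lies on a
horizontal segment from it to a point of the domain many times farther away, so convexity along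
that segment, together with `v ≤ C x_n`, yields `v(x) ≤ C r^(1 + δ/2)`
(`QuadraticProblem.exists_sub_le_rpow`).

The comparison principle is elementary: where a convex quadratic barrier `ψ` exceeds `u`, every
tangent plane of `ψ` can be lowered until it supports `u` there, so the image of that set under `∇ψ`
is contained in the set of subgradients of `u` on it, and the volumes disagree.
-/

namespace BoundaryMA

/-! ### Coordinates -/

section Coordinates

variable {d : ℕ}

/-- The point `(y, h)` of `ℝⁿ` with tangential part `y` and last coordinate `h`. -/
def point (y : E d) (h : ℝ) : E (d + 1) :=
  WithLp.toLp 2 (Fin.snoc (α := fun _ => ℝ) (fun i => y i) h)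

@[simp] lemma tang_point (y : E d) (h : ℝ) : tang (point y h) = y := by
  ext i; simp [tang, point]

@[simp] lemma lastCoord_point (y : E d) (h : ℝ) : lastCoord (point y h) = h := by
  simp [lastCoord, point]

@[simp] lemma tang_add (x y : E (d + 1)) : tang (x + y) = tang x + tang y := by
  ext i; simp [tang]

@[simp] lemma tang_sub (x y : E (d + 1)) : tang (x - y) = tang x - tang y := by
  ext i; simp [tang]

@[simp] lemma tang_smul (c : ℝ) (x : E (d + 1)) : tang (c • x) = c • tang x := by
  ext i; simp [tang]

@[simp] lemma tang_zero : tang (0 : E (d + 1)) = 0 := by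
  ext i; simp [tang]

@[simp] lemma tang_eLast : tang (eLast d) = 0 := by
  ext i; simp [tang, eLast, Fin.castSucc_ne_last]

@[simp] lemma lastCoord_add (x y : E (d + 1)) :
    lastCoord (x + y) = lastCoord x + lastCoord y := by
  simp [lastCoord]

@[simp] lemma lastCoord_sub (x y : E (d + 1)) :
    lastCoord (x - y) = lastCoord x - lastCoord y := by
  simp [lastCoord]

@[simp] lemma lastCoord_smul (c : ℝ) (x : E (d + 1)) :
    lastCoord (c • x) = c * lastCoord x := by
  simp [lastCoord]

@[simp] lemma lastCoord_zero : lastCoord (0 : E (d + 1)) = 0 := by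
  simp [lastCoord]

@[simp] lemma lastCoord_eLast : lastCoord (eLast d) = 1 := by
  simp [lastCoord, eLast]

lemma inner_eLast (x : E (d + 1)) : inner ℝ (eLast d) x = lastCoord x := by
  simp [lastCoord, eLast, EuclideanSpace.inner_single_left]

lemma inner_eq_tang_add (x y : E (d + 1)) :
    inner ℝ x y = inner ℝ (tang x) (tang y) + lastCoord x * lastCoord y := by
  simp [PiLp.inner_apply, Fin.sum_univ_castSucc, tang, lastCoord, mul_comm]

lemma norm_sq_eq_tang_add (x : E (d + 1)) :
    ‖x‖ ^ 2 = ‖tang x‖ ^ 2 + lastCoord x ^ 2 := by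
  rw [← real_inner_self_eq_norm_sq, ← real_inner_self_eq_norm_sq, inner_eq_tang_add, sq]

lemma norm_tang_le (x : E (d + 1)) : ‖tang x‖ ≤ ‖x‖ :=
  abs_le_of_sq_le_sq' (by nlinarith [norm_sq_eq_tang_add x, sq_nonneg (lastCoord x)])
    (norm_nonneg _) |>.2

lemma abs_lastCoord_le (x : E (d + 1)) : |lastCoord x| ≤ ‖x‖ :=
  abs_le_of_sq_le_sq (by nlinarith [norm_sq_eq_tang_add x, sq_nonneg ‖tang x‖]) (norm_nonneg _)

lemma norm_le_tang_add (x : E (d + 1)) : ‖x‖ ≤ ‖tang x‖ + |lastCoord x| := by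
  refine abs_le_of_sq_le_sq' ?_ (by positivity) |>.2
  nlinarith [norm_sq_eq_tang_add x, sq_abs (lastCoord x),
    mul_nonneg (norm_nonneg (tang x)) (abs_nonneg (lastCoord x))]

lemma continuous_lastCoord : Continuous (lastCoord : E (d + 1) → ℝ) := by
  unfold lastCoord; fun_prop

lemma continuous_tang : Continuous (tang : E (d + 1) → E d) := by
  unfold tang; fun_prop

lemma point_tang_lastCoord (x : E (d + 1)) : point (tang x) (lastCoord x) = x := by
  ext i
  refine Fin.lastCases ?_ (fun j => ?_) i <;> simp [point, tang, lastCoord]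

end Coordinates

/-! ### Convex functions and domains -/

/-- A segment from a point of the closure of `s` to a point outside it meets the boundary of `s`. -/
lemma exists_mem_frontier_segment {V : Type*} [AddCommGroup V] [Module ℝ V]
    [TopologicalSpace V] [ContinuousAdd V] [ContinuousSMul ℝ V] {s : Set V} {x y : V}
    (hx : x ∈ closure s) (hy : y ∉ closure s) :
    ∃ t : ℝ, 0 ≤ t ∧ t ≤ 1 ∧ (1 - t) • x + t • y ∈ frontier s := by
  have hpre : IsPreconnected (segment ℝ x y) := (convex_segment x y).isPreconnected
  have hne : (segment ℝ x y ∩ frontier s).Nonempty := by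
    by_contra hcon
    rw [not_nonempty_iff_eq_empty] at hcon
    have hnf : ∀ z ∈ segment ℝ x y, z ∉ frontier s := fun z hz hf => by
      have : z ∈ segment ℝ x y ∩ frontier s := ⟨hz, hf⟩
      rw [hcon] at this; exact this
    obtain ⟨z, -, hz⟩ := hpre (interior s) (closure s)ᶜ isOpen_interior isClosed_closure.isOpen_compl
      (fun z hz => by
        by_cases h : z ∈ closure s
        · left
          by_contra hi
          exact hnf z hz ⟨h, hi⟩
        · right; exact h)
      ⟨x, left_mem_segment ℝ x y, by
        by_contra hi
        exact hnf x (left_mem_segment ℝ x y) ⟨hx, hi⟩⟩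
      ⟨y, right_mem_segment ℝ x y, hy⟩
    exact hz.2 (interior_subset_closure hz.1)
  obtain ⟨z, ⟨a, b, ha, hb, hab, rfl⟩, hz⟩ := hne
  refine ⟨b, hb, by linarith, ?_⟩
  rwa [show 1 - b = a by linarith]

/-- Maximum principle: on a bounded domain a convex function is bounded by its boundary values. -/
lemma convexOn_le_of_frontier_le {V : Type*} [NormedAddCommGroup V] [NormedSpace ℝ V]
    [Nontrivial V] {s : Set V} (hs : Bornology.IsBounded s) {w : V → ℝ} {c : ℝ}
    (hw : ConvexOn ℝ (closure s) w) (hb : ∀ x ∈ frontier s, w x ≤ c) :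
    ∀ x ∈ closure s, w x ≤ c := by
  intro x hx
  obtain ⟨e, he⟩ := exists_ne (0 : V)
  obtain ⟨R, hR⟩ := hs.closure.exists_norm_le
  have hR0 : 0 ≤ R := (norm_nonneg x).trans (hR x hx)
  have he' : 0 < ‖e‖ := norm_pos_iff.2 he
  -- a point outside the closure on each half line through `x`
  have key : ∀ σ : ℝ, |σ| = 1 → ∃ t : ℝ, 0 ≤ t ∧ x + (σ * t) • e ∈ frontier s := by
    intro σ hσ
    set T : ℝ := (2 * R + 1) / ‖e‖ with hT
    have hT0 : 0 ≤ T := by positivity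
    have hout : x + (σ * T) • e ∉ closure s := by
      intro hmem
      have h1 := hR _ hmem
      have h2 : ‖(σ * T) • e‖ = 2 * R + 1 := by
        rw [norm_smul, Real.norm_eq_abs, abs_mul, hσ, abs_of_nonneg hT0, hT]
        field_simp
      have h3 : ‖(σ * T) • e‖ ≤ ‖x + (σ * T) • e‖ + ‖x‖ := by
        simpa using norm_sub_le (x + (σ * T) • e) x
      linarith [hR x hx]
    obtain ⟨t, ht0, -, ht⟩ := exists_mem_frontier_segment hx hout
    refine ⟨t * T, by positivity, ?_⟩
    convert ht using 1
    module
  obtain ⟨t₁, h1, hf1⟩ := key 1 (by simp)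
  obtain ⟨t₂, h2, hf2⟩ := key (-1) (by simp)
  rcases (add_nonneg h1 h2).eq_or_lt with h0 | h0
  · have : t₁ = 0 := by linarith
    rw [this] at hf1
    simpa using hb _ hf1
  · have hconv := hw.2 (frontier_subset_closure hf1) (frontier_subset_closure hf2)
      (show 0 ≤ t₂ / (t₁ + t₂) by positivity) (show 0 ≤ t₁ / (t₁ + t₂) by positivity)
      (by field_simp; ring)
    have hx' : (t₂ / (t₁ + t₂)) • (x + (1 * t₁) • e) + (t₁ / (t₁ + t₂)) • (x + (-1 * t₂) • e)
        = x := by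
      have : (t₂ / (t₁ + t₂)) + (t₁ / (t₁ + t₂)) = 1 := by field_simp; ring
      have h2 : (t₂ / (t₁ + t₂)) * t₁ = (t₁ / (t₁ + t₂)) * t₂ := by field_simp
      calc _ = ((t₂ / (t₁ + t₂)) + (t₁ / (t₁ + t₂))) • x
              + ((t₂ / (t₁ + t₂)) * t₁ - (t₁ / (t₁ + t₂)) * t₂) • e := by module
        _ = x := by rw [this, h2]; simp
    rw [hx'] at hconv
    refine hconv.trans ?_
    have e1 := mul_le_mul_of_nonneg_left (hb _ hf1) (show 0 ≤ t₂ / (t₁ + t₂) by positivity)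
    have e2 := mul_le_mul_of_nonneg_left (hb _ hf2) (show 0 ≤ t₁ / (t₁ + t₂) by positivity)
    have e3 : t₂ / (t₁ + t₂) * c + t₁ / (t₁ + t₂) * c = c := by field_simp; ring
    simp only [smul_eq_mul]
    linarith

/-! ### Comparison with quadratic barriers -/

/-- The volume of the image of `s` under `x ↦ b + diag(w) x`. -/
lemma volume_image_add_diagonal {k : ℕ} (w : Fin k → ℝ) (b : E k) (s : Set (E k)) :
    volume ((fun x : E k => b + WithLp.toLp 2 (fun i => w i * x i)) '' s)
      = ENNReal.ofReal |∏ i, w i| * volume s := by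
  have h1 : (fun x : E k => b + WithLp.toLp 2 (fun i => w i * x i)) '' s
      = (fun y => b + y) '' ((Matrix.toLpLin 2 2 (Matrix.diagonal w)) '' s) := by
    rw [Set.image_image]
    refine Set.image_congr fun x _ => ?_
    congr 1
    ext i
    simp [Matrix.mulVec_diagonal]
  rw [h1, Set.image_add_left, measure_preimage_add, Measure.addHaar_image_linearMap,
    Matrix.toLpLin_eq_toLin, LinearMap.det_toLin, Matrix.det_diagonal]

/-- Comparison principle: a convex function whose Monge–Ampère measure is at most `L dx` lies above
every convex quadratic polynomial with Hessian determinant larger than `L` that lies below it on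
the boundary. -/
theorem quadratic_le_of_le_boundary {k : ℕ} {Ω D : Set (E k)} {u : E k → ℝ} {L : ℝ}
    (hL : 0 ≤ L) (hconv : ConvexOn ℝ Ω u) (hD : IsOpen D) (hDΩ : D ⊆ Ω)
    (hDb : Bornology.IsBounded D) (hcont : ContinuousOn u (closure D))
    (hMA : ∀ S ⊆ Ω, MeasurableSet S →
      volume (⋃ x ∈ S, subdiff Ω u x) ≤ ENNReal.ofReal L * volume S)
    {w : Fin k → ℝ} (hw : ∀ i, 0 ≤ w i) (hdet : L < ∏ i, (2 * w i)) (c : ℝ) (b : E k)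
    (hbd : ∀ x ∈ closure D, x ∉ D → c + inner ℝ b x + ∑ i, w i * x i ^ 2 ≤ u x) :
    ∀ x ∈ D, c + inner ℝ b x + ∑ i, w i * x i ^ 2 ≤ u x := by
  set ψ : E k → ℝ := fun x => c + inner ℝ b x + ∑ i, w i * x i ^ 2 with hψ
  set G : E k → E k := fun x => b + WithLp.toLp 2 (fun i => (2 * w i) * x i) with hG
  have hψc : Continuous ψ := by rw [hψ]; fun_prop
  have htan : ∀ x y, ψ x + inner ℝ (G x) (y - x) ≤ ψ y := by
    intro x y
    have : ψ y - (ψ x + inner ℝ (G x) (y - x)) = ∑ i, w i * (y i - x i) ^ 2 := by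
      simp only [hψ, hG, inner_add_left, inner_sub_right, PiLp.inner_apply, RCLike.inner_apply,
        conj_trivial]
      have : ∀ i, w i * (y i - x i) ^ 2
          = w i * y i ^ 2 - w i * x i ^ 2 - (y i * (2 * w i * x i) - x i * (2 * w i * x i)) := by
        intro i; ring
      simp only [this, Finset.sum_sub_distrib]
      ring
    have h0 : 0 ≤ ∑ i, w i * (y i - x i) ^ 2 :=
      Finset.sum_nonneg fun i _ => mul_nonneg (hw i) (sq_nonneg _)
    linarith
  by_contra hcon
  push Not at hcon
  obtain ⟨x₁, hx₁D, hx₁⟩ := hcon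
  set D' : Set (E k) := {x ∈ D | u x < ψ x} with hD'
  have hD'D : D' ⊆ D := fun x hx => hx.1
  have hD'o : IsOpen D' := by
    have h1 : ContinuousOn (fun x => u x - ψ x) D :=
      (hcont.mono subset_closure).sub hψc.continuousOn
    have h2 := h1.isOpen_inter_preimage hD (isOpen_Iio (a := (0 : ℝ)))
    convert h2 using 1
    ext x
    simp [hD']
  have hne : D'.Nonempty := ⟨x₁, hx₁D, hx₁⟩
  have hb' : Bornology.IsBounded D' := hDb.subset hD'D
  have hcpt : IsCompact (closure D') := hb'.isCompact_closure
  -- every tangent plane of the barrier at a point of `D'`, slid down, touches `u` inside `D'`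
  have hsub : G '' D' ⊆ ⋃ x ∈ D', subdiff Ω u x := by
    rintro _ ⟨x, hx, rfl⟩
    have hcl : closure D' ⊆ closure D := closure_mono hD'D
    have hc : ContinuousOn (fun y => u y - inner ℝ (G x) y) (closure D') :=
      (hcont.mono hcl).sub (by fun_prop)
    obtain ⟨z, hz, hmin⟩ := hcpt.exists_isMinOn (hne.mono subset_closure) hc
    have hzx := hmin (subset_closure hx)
    simp only [mem_ofPred_eq] at hzx
    have htz := htan x z
    rw [inner_sub_right] at htz
    have hzψ : u z < ψ z := by linarith [hx.2]
    have hzD : z ∈ D := by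
      by_contra hzD
      exact absurd (hbd z (hcl hz) hzD) (not_le.2 hzψ)
    have hzD' : z ∈ D' := ⟨hzD, hzψ⟩
    have hloc : IsLocalMinOn (fun y => u y - inner ℝ (G x) y) Ω z := by
      have : D' ∈ 𝓝 z := hD'o.mem_nhds hzD'
      filter_upwards [mem_nhdsWithin_of_mem_nhds this] with y hy
      exact hmin (subset_closure hy)
    have hcv : ConvexOn ℝ Ω (fun y => u y - inner ℝ (G x) y) :=
      hconv.sub ((innerₛₗ ℝ (G x)).concaveOn hconv.1)
    have hglob := IsMinOn.of_isLocalMinOn_of_convexOn (hDΩ hzD) hloc hcv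
    simp only [mem_iUnion]
    refine ⟨z, hzD', fun y hy => ?_⟩
    have := hglob hy
    simp only [mem_ofPred_eq] at this
    rw [inner_sub_right]
    linarith
  have hvol := (measure_mono hsub).trans (hMA D' (hD'D.trans hDΩ) hD'o.measurableSet)
  rw [hG, volume_image_add_diagonal] at hvol
  have hpos : 0 < volume D' := hD'o.measure_pos volume hne
  have hfin : volume D' ≠ ⊤ := hb'.measure_lt_top.ne
  rw [ENNReal.mul_le_mul_iff_left hpos.ne' hfin] at hvol
  have hprod : 0 ≤ ∏ i, (2 * w i) := Finset.prod_nonneg fun i _ => by linarith [hw i]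
  rw [abs_of_nonneg hprod] at hvol
  rw [ENNReal.ofReal_le_ofReal_iff hL] at hvol
  linarith

/-! ### Domains whose boundary is quadratic to order `2 + α` at the origin -/

variable {d : ℕ}

lemma rpow_two_add {r α : ℝ} (hr : 0 ≤ r) (hα : 0 < α) : r ^ (2 + α) = r ^ 2 * r ^ α := by
  rw [Real.rpow_add' hr (by linarith), Real.rpow_two]

lemma rpow_two_add_le {r α : ℝ} (hr : 0 ≤ r) (hr1 : r ≤ 1) (hα : 0 < α) :
    r ^ (2 + α) ≤ r ^ 2 := by
  rw [rpow_two_add hr hα]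
  exact mul_le_of_le_one_right (by positivity) (Real.rpow_le_one hr hr1 hα.le)

lemma exists_small_mul_lt {a b : ℝ} (ha : 0 < a) (hb : 0 < b) (A B : ℝ) :
    ∃ s : ℝ, 0 < s ∧ s < 1 ∧ s * A < a ∧ s * B < b := by
  have key : ∀ A a : ℝ, 0 < a → ∀ᶠ s in 𝓝[>] (0 : ℝ), s * A < a := fun A a ha => by
    have hc : Continuous fun s : ℝ => s * A := by fun_prop
    have ht : Tendsto (fun s : ℝ => s * A) (𝓝 0) (𝓝 0) := by simpa using hc.tendsto 0
    exact nhdsWithin_le_nhds (ht (Iio_mem_nhds ha))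
  obtain ⟨s, ⟨⟨h1, h2⟩, h3⟩, h4⟩ :=
    (((key 1 1 one_pos).and (key A a ha)).and (key B b hb)).and self_mem_nhdsWithin |>.exists
  exact ⟨s, h4, by linarith, h2, h3⟩

lemma norm_smul_add_smul_le {V : Type*} [NormedAddCommGroup V] [NormedSpace ℝ V] {a b : ℝ}
    (ha : 0 ≤ a) (hb : 0 ≤ b) (x y : V) : ‖a • x + b • y‖ ≤ a * ‖x‖ + b * ‖y‖ := by
  have h1 := norm_add_le (a • x) (b • y)
  rwa [norm_smul, norm_smul, Real.norm_of_nonneg ha, Real.norm_of_nonneg hb] at h1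

lemma abs_half_inner_apply_le (B : E d →L[ℝ] E d) {M : ℝ} (hB : ‖B‖ ≤ M) (y : E d) :
    |(1 / 2) * inner ℝ (B y) y| ≤ M / 2 * ‖y‖ ^ 2 := by
  rw [abs_mul, abs_of_pos (by norm_num : (0 : ℝ) < 1 / 2)]
  have h1 := abs_real_inner_le_norm (B y) y
  have h2 := B.le_of_opNorm_le hB y
  nlinarith [norm_nonneg y, mul_le_mul_of_nonneg_right h2 (norm_nonneg y)]

/-- A convex domain in the upper half space, uniformly convex at its boundary point `0`, whose
boundary is within `M |x'|^(2+α)` of the graph of `(1/2) (B x') · x'` in the ball of radius `ρ`. -/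
structure QuadraticDomain (α M κ ρ : ℝ) (Ω : Set (E (d + 1))) (B : E d →L[ℝ] E d) : Prop where
  isOpen : IsOpen Ω
  convex : Convex ℝ Ω
  zero_mem_frontier : (0 : E (d + 1)) ∈ frontier Ω
  lastCoord_pos : ∀ x ∈ Ω, 0 < lastCoord x
  uniformlyConvex : UniformlyConvexAt κ Ω 0 (eLast d)
  norm_le : ‖B‖ ≤ M
  near : ∀ x ∈ frontier Ω, ‖x‖ < ρ →
    |lastCoord x - (1 / 2) * inner ℝ (B (tang x)) (tang x)| ≤ M * ‖tang x‖ ^ (2 + α)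

lemma UniformlyConvexAt.sq_le {κ : ℝ} {Ω : Set (E (d + 1))}
    (h : UniformlyConvexAt κ Ω 0 (eLast d)) {x : E (d + 1)} (hx : x ∈ closure Ω) :
    κ * ‖x‖ ^ 2 ≤ lastCoord x := by
  have hc : IsClosed {x : E (d + 1) | κ * ‖x‖ ^ 2 ≤ lastCoord x} :=
    isClosed_le (by fun_prop) continuous_lastCoord
  refine closure_minimal (fun y hy => ?_) hc hx
  have := h y hy
  rwa [sub_zero, inner_eLast] at this

namespace QuadraticDomain

variable {α M κ ρ : ℝ} {Ω : Set (E (d + 1))} {B : E d →L[ℝ] E d}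

lemma zero_mem (h : QuadraticDomain α M κ ρ Ω B) : (0 : E (d + 1)) ∈ closure Ω :=
  h.zero_mem_frontier.1

lemma nonempty (h : QuadraticDomain α M κ ρ Ω B) : Ω.Nonempty :=
  closure_nonempty_iff.1 ⟨0, h.zero_mem⟩

lemma sq_le (h : QuadraticDomain α M κ ρ Ω B) {x : E (d + 1)} (hx : x ∈ closure Ω) :
    κ * ‖x‖ ^ 2 ≤ lastCoord x :=
  h.uniformlyConvex.sq_le hx

lemma lastCoord_nonneg (h : QuadraticDomain α M κ ρ Ω B) (hκ : 0 < κ) {x : E (d + 1)}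
    (hx : x ∈ closure Ω) : 0 ≤ lastCoord x :=
  le_trans (by positivity) (h.sq_le hx)

lemma norm_le_inv (h : QuadraticDomain α M κ ρ Ω B) (hκ : 0 < κ) {x : E (d + 1)}
    (hx : x ∈ closure Ω) : ‖x‖ ≤ κ⁻¹ := by
  have h1 := h.sq_le hx
  have h2 := (le_abs_self _).trans (abs_lastCoord_le x)
  rcases (norm_nonneg x).eq_or_lt with h0 | h0
  · rw [← h0]; positivity
  · have : κ * ‖x‖ ≤ 1 := by nlinarith
    rw [← one_div, le_div_iff₀ hκ]; linarith

lemma isBounded (h : QuadraticDomain α M κ ρ Ω B) (hκ : 0 < κ) : Bornology.IsBounded Ω :=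
  isBounded_iff_forall_norm_le.2 ⟨κ⁻¹, fun _ hx => h.norm_le_inv hκ (subset_closure hx)⟩

lemma smul_mem (h : QuadraticDomain α M κ ρ Ω B) {x : E (d + 1)} (hx : x ∈ closure Ω) {t : ℝ}
    (ht0 : 0 ≤ t) (ht1 : t ≤ 1) : t • x ∈ closure Ω :=
  h.convex.closure.smul_mem_of_zero_mem h.zero_mem hx ⟨ht0, ht1⟩

lemma lastCoord_le (h : QuadraticDomain α M κ ρ Ω B) (hα : 0 < α) (hM : 1 ≤ M)
    {x : E (d + 1)} (hx : x ∈ frontier Ω) (hxρ : ‖x‖ < ρ) (hx1 : ‖x‖ ≤ 1) :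
    lastCoord x ≤ 2 * M * ‖tang x‖ ^ 2 := by
  have h1 := (abs_le.1 (h.near x hx hxρ)).2
  have h2 := (abs_le.1 (abs_half_inner_apply_le B h.norm_le (tang x))).2
  have h3 := rpow_two_add_le (norm_nonneg (tang x)) ((norm_tang_le x).trans hx1) hα
  have h4 := mul_le_mul_of_nonneg_left h3 (by linarith : 0 ≤ M)
  linarith [mul_nonneg (by linarith : 0 ≤ M) (sq_nonneg ‖tang x‖)]

/-- The domain contains a paraboloid-shaped neighbourhood of `0` of controlled size: otherwise a
segment from `s z`, with `z ∈ Ω` and `s` small, to a point of that region would meet the boundary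
too high above the plane `x_n = 0`. -/
theorem exists_region (hα : 0 < α) (hM : 1 ≤ M) (hρ : 0 < ρ) :
    ∃ c s₀ : ℝ, 0 < c ∧ 0 < s₀ ∧ ∀ (Ω : Set (E (d + 1))) (B : E d →L[ℝ] E d),
      QuadraticDomain α M κ ρ Ω B → ∀ x : E (d + 1), 0 ≤ lastCoord x → lastCoord x ≤ s₀ →
        ‖tang x‖ ^ 2 ≤ c * lastCoord x → x ∈ closure Ω ∧ ‖x‖ < ρ ∧ ‖x‖ ≤ 1 := by
  set m := min ρ 1 with hm
  have hm0 : 0 < m := lt_min hρ one_pos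
  have hm1 : m ≤ 1 := min_le_right _ _
  have hmρ : m ≤ ρ := min_le_left _ _
  refine ⟨1 / (8 * M), (m / 4) ^ 2, by positivity, by positivity, fun Ω B h x hx0 hxs hxt => ?_⟩
  have hc1 : 1 / (8 * M) ≤ 1 := by
    rw [div_le_one (by positivity)]; linarith
  have hxn : ‖x‖ ≤ m / 2 := by
    have h1 : ‖tang x‖ ≤ m / 4 := by
      refine abs_le_of_sq_le_sq' ?_ (by positivity) |>.2
      exact hxt.trans ((mul_le_of_le_one_left hx0 hc1).trans hxs)
    have h2 : |lastCoord x| ≤ m / 4 := by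
      rw [abs_of_nonneg hx0]; nlinarith
    linarith [norm_le_tang_add x]
  refine ⟨?_, by linarith, by linarith⟩
  by_contra hxout
  have hx0' : 0 < lastCoord x := by
    rcases hx0.eq_or_lt with h0 | h0
    · exfalso
      apply hxout
      have h1 : ‖x‖ ^ 2 = 0 := by
        rw [norm_sq_eq_tang_add, ← h0]
        rw [← h0, mul_zero] at hxt
        linarith [sq_nonneg ‖tang x‖]
      have h2 : x = 0 := by simpa using h1
      rw [h2]; exact h.zero_mem
    · exact h0
  obtain ⟨z, hz⟩ := h.nonempty
  have hz0 := h.lastCoord_pos z hz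
  -- `s` small enough for the contribution of `s z` to the quadratic bound to be negligible
  obtain ⟨s, hs0, hs1, hs2, hs3⟩ :=
    exists_small_mul_lt (by positivity : 0 < m / 4) hz0 ‖z‖ (8 * M * ‖tang z‖ ^ 2)
  obtain ⟨τ, hτ0, hτ1, hy⟩ := exists_mem_frontier_segment
    (h.smul_mem (subset_closure hz) hs0.le hs1.le) hxout
  set a := (1 - τ) * s with ha
  have ha0 : 0 ≤ a := mul_nonneg (by linarith) hs0.le
  have has : a ≤ s := by nlinarith
  rw [smul_smul, ← ha] at hy
  have hyn : ‖a • z + τ • x‖ ≤ 3 * m / 4 := by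
    have h1 := norm_smul_add_smul_le ha0 hτ0 z x
    have h2 := mul_le_mul_of_nonneg_right has (norm_nonneg z)
    have h3 := mul_le_mul_of_nonneg_right hτ1 (norm_nonneg x)
    linarith
  have hle := h.lastCoord_le hα hM hy (by linarith) (by linarith)
  simp only [lastCoord_add, lastCoord_smul, tang_add, tang_smul] at hle
  have hsq : ‖a • tang z + τ • tang x‖ ^ 2 ≤ 2 * (a ^ 2 * ‖tang z‖ ^ 2 + τ ^ 2 * ‖tang x‖ ^ 2) := by
    have h1 := norm_smul_add_smul_le ha0 hτ0 (tang z) (tang x)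
    have h2 := pow_le_pow_left₀ (norm_nonneg _) h1 2
    linarith [sq_nonneg (a * ‖tang z‖ - τ * ‖tang x‖)]
  have h1 : 4 * M * (a ^ 2 * ‖tang z‖ ^ 2) ≤ a * lastCoord z / 2 := by
    have : a * (8 * M * ‖tang z‖ ^ 2) ≤ lastCoord z :=
      (mul_le_mul_of_nonneg_right has (by positivity)).trans hs3.le
    linarith [mul_le_mul_of_nonneg_left this ha0]
  have h2 : 4 * M * (τ ^ 2 * ‖tang x‖ ^ 2) ≤ τ * lastCoord x / 2 := by
    have h3 : 8 * M * ‖tang x‖ ^ 2 ≤ lastCoord x := by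
      have := mul_le_mul_of_nonneg_left hxt (by positivity : 0 ≤ 8 * M)
      rwa [← mul_assoc, mul_one_div_cancel (by positivity), one_mul] at this
    have h4 : τ ^ 2 ≤ τ := by nlinarith
    linarith [mul_le_mul h4 h3 (by positivity) hτ0]
  have h3 : 0 < a * lastCoord z + τ * lastCoord x := by
    rcases hτ0.eq_or_lt with h0 | h0
    · have : a = s := by rw [ha, ← h0]; ring
      rw [this, ← h0]; positivity
    · have := mul_nonneg ha0 hz0.le
      positivity
  linarith [mul_le_mul_of_nonneg_left hsq (by linarith : 0 ≤ 2 * M)]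

/-- Above every small `y` there is a boundary point: the vertical segment over `y` starts outside the
domain at height `0` and ends inside the region of `exists_region`. -/
lemma exists_frontier_point (h : QuadraticDomain α M κ ρ Ω B) (hκ : 0 < κ) {c s₀ : ℝ} (hc : 0 < c)
    (hreg : ∀ x : E (d + 1), 0 ≤ lastCoord x → lastCoord x ≤ s₀ →
        ‖tang x‖ ^ 2 ≤ c * lastCoord x → x ∈ closure Ω ∧ ‖x‖ < ρ ∧ ‖x‖ ≤ 1)
    {y : E d} (hy : ‖y‖ ^ 2 ≤ c * s₀) :
    ∃ x ∈ frontier Ω, tang x = y ∧ 0 ≤ lastCoord x ∧ lastCoord x ≤ ‖y‖ ^ 2 / c ∧ ‖x‖ < ρ ∧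
      ‖x‖ ≤ 1 := by
  rcases eq_or_ne y 0 with rfl | hy0
  · refine ⟨0, h.zero_mem_frontier, by simp, by simp, by simp, ?_⟩
    have hs : 0 ≤ s₀ := by
      by_contra hs
      have := mul_neg_of_pos_of_neg hc (not_le.1 hs)
      simp at hy
      linarith
    have := hreg 0 (by simp) (by simpa using hs) (by simp)
    exact this.2
  have htop := hreg (point y (‖y‖ ^ 2 / c)) (by simp; positivity)
    (by rw [lastCoord_point, div_le_iff₀ hc]; linarith)
    (by rw [tang_point, lastCoord_point]; exact le_of_eq (by field_simp))
  have hbot : point y 0 ∉ closure Ω := by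
    intro hmem
    have h1 := h.sq_le hmem
    rw [norm_sq_eq_tang_add] at h1
    simp only [tang_point, lastCoord_point] at h1
    have : 0 < κ * (‖y‖ ^ 2 + 0 ^ 2) := by
      have := norm_pos_iff.2 hy0
      positivity
    linarith
  obtain ⟨t, ht0, ht1, ht⟩ := exists_mem_frontier_segment htop.1 hbot
  set x := (1 - t) • point y (‖y‖ ^ 2 / c) + t • point y 0 with hx
  have htx : tang x = y := by
    simp only [hx, tang_add, tang_smul, tang_point]; module
  have hlx : lastCoord x = (1 - t) * (‖y‖ ^ 2 / c) := by
    simp [hx]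
  have hl0 : 0 ≤ lastCoord x := by
    rw [hlx]; exact mul_nonneg (by linarith) (by positivity)
  have hl1 : lastCoord x ≤ ‖y‖ ^ 2 / c := by
    rw [hlx]; exact mul_le_of_le_one_left (by positivity) (by linarith)
  have hnorm : ‖x‖ ≤ ‖point y (‖y‖ ^ 2 / c)‖ := by
    refine abs_le_of_sq_le_sq' ?_ (norm_nonneg _) |>.2
    rw [norm_sq_eq_tang_add, norm_sq_eq_tang_add, htx, tang_point, lastCoord_point]
    gcongr
  exact ⟨x, ht, htx, hl0, hl1, hnorm.trans_lt htop.2.1, hnorm.trans htop.2.2⟩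

end QuadraticDomain

lemma lastCoord_nonneg_of_mem_closure {Ω : Set (E (d + 1))} (hpos : ∀ x ∈ Ω, 0 < lastCoord x)
    {x : E (d + 1)} (hx : x ∈ closure Ω) : 0 ≤ lastCoord x := by
  have hcl : IsClosed {x : E (d + 1) | 0 ≤ lastCoord x} :=
    isClosed_le continuous_const continuous_lastCoord
  exact closure_minimal (fun y hy => (hpos y hy).le) hcl hx

/-- If the boundary of a convex domain in the upper half space is the graph of a quadratic
polynomial at `0` to order larger than `1`, then that polynomial has no linear part: the boundary
of the tangent cone at `0` is a hyperplane, and it bounds a cone inside the upper half space. -/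
theorem linear_part_eq_zero {α M ρ : ℝ} {Ω : Set (E (d + 1))} {B : E d →L[ℝ] E d} {b : E d}
    (hα : 0 < α) (hM : 1 ≤ M) (hρ : 0 < ρ) (hΩ : IsOpen Ω) (hconv : Convex ℝ Ω)
    (hpos : ∀ x ∈ Ω, 0 < lastCoord x) (h0 : (0 : E (d + 1)) ∈ frontier Ω)
    (hB : ‖B‖ ≤ M)
    (hnear : ∀ x ∈ frontier Ω, ‖x‖ < ρ →
      |lastCoord x - quadPoly 0 b B (tang x)| ≤ M * ‖tang x‖ ^ (2 + α)) : b = 0 := by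
  by_contra hb
  have hb' : 0 < ‖b‖ := norm_pos_iff.2 hb
  set ℓ : E (d + 1) → ℝ := fun x => lastCoord x - inner ℝ b (tang x) with hℓ
  have hℓc : Continuous ℓ := continuous_lastCoord.sub (continuous_const.inner continuous_tang)
  obtain ⟨z, hz, hσ⟩ : ∃ z ∈ Ω, ℓ z ≠ 0 := by
    obtain ⟨z₀, hz₀⟩ := closure_nonempty_iff.1 (⟨0, h0.1⟩ : (closure Ω).Nonempty)
    by_cases hz : ℓ z₀ = 0
    · have hcont : Continuous fun η : ℝ => z₀ + η • eLast d := by fun_prop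
      have hmem : ∀ᶠ η in 𝓝[>] (0 : ℝ), z₀ + η • eLast d ∈ Ω :=
        (hcont.continuousAt.eventually (hΩ.mem_nhds (by simpa using hz₀))).filter_mono
          nhdsWithin_le_nhds
      obtain ⟨η, hη, hη0⟩ := (hmem.and self_mem_nhdsWithin).exists
      refine ⟨_, hη, ?_⟩
      have : ℓ (z₀ + η • eLast d) = ℓ z₀ + η := by simp [hℓ]; ring
      rw [this, hz, zero_add]
      exact ne_of_gt hη0
    · exact ⟨z₀, hz₀, hz⟩
  set σ := ℓ z with hσdef
  have hσ2 : 0 < σ ^ 2 := by positivity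
  -- a point below the upper half space on the same side of the hyperplane `ℓ = 0` as `z`
  set w : E (d + 1) := point (-((σ + 1) / (σ ^ 2 * ‖b‖ ^ 2) * σ) • b) (-1) with hw
  have hwℓ : σ * ℓ w = 1 := by
    simp only [hℓ, hw, lastCoord_point, tang_point, inner_smul_right, real_inner_self_eq_norm_sq]
    field_simp
    ring
  set m := min (σ ^ 2) 1 with hm
  have hm0 : 0 < m := lt_min hσ2 one_pos
  set R := ‖z‖ + ‖w‖ + 1 with hR
  have hR0 : 0 < R := by positivity
  obtain ⟨s, hs0, hs1, hs2, hs3⟩ :=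
    exists_small_mul_lt (lt_min hρ one_pos) hm0 R (|σ| * (2 * M * R ^ 2))
  have hout : s • w ∉ closure Ω := by
    intro hmem
    have := lastCoord_nonneg_of_mem_closure hpos hmem
    rw [lastCoord_smul, hw, lastCoord_point] at this
    linarith
  have hsz : s • z ∈ closure Ω :=
    hconv.closure.smul_mem_of_zero_mem h0.1 (subset_closure hz) ⟨hs0.le, hs1.le⟩
  obtain ⟨τ, hτ0, hτ1, hy⟩ := exists_mem_frontier_segment hsz hout
  set p := (1 - τ) • z + τ • w with hp
  have hyp : (1 - τ) • s • z + τ • s • w = s • p := by rw [hp]; module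
  rw [hyp] at hy
  have hpR : ‖p‖ ≤ R := by
    have h1 := norm_smul_add_smul_le (by linarith : 0 ≤ 1 - τ) hτ0 z w
    have h2 := mul_le_mul_of_nonneg_right (by linarith : 1 - τ ≤ 1) (norm_nonneg z)
    have h3 := mul_le_mul_of_nonneg_right hτ1 (norm_nonneg w)
    linarith
  have hspR : ‖s • p‖ ≤ s * R := by
    rw [norm_smul, Real.norm_of_nonneg hs0.le]; gcongr
  have hsp := hnear _ hy (hspR.trans_lt (hs2.trans_le (min_le_left _ _)))
  have hsp1 : ‖s • p‖ ≤ 1 := hspR.trans (hs2.le.trans (min_le_right _ _))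
  have hT : ‖tang (s • p)‖ ≤ s * R := (norm_tang_le _).trans hspR
  have hq := abs_half_inner_apply_le B hB (tang (s • p))
  have hrp := rpow_two_add_le (norm_nonneg (tang (s • p))) ((norm_tang_le _).trans hsp1) hα
  have hℓp : |ℓ (s • p)| ≤ 2 * M * ‖tang (s • p)‖ ^ 2 := by
    have : ℓ (s • p) = (lastCoord (s • p) - quadPoly 0 b B (tang (s • p)))
        + (1 / 2) * inner ℝ (B (tang (s • p))) (tang (s • p)) := by
      simp only [hℓ, quadPoly]; ring
    rw [this]
    refine (abs_add_le _ _).trans ?_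
    linarith [mul_le_mul_of_nonneg_left hrp (by linarith : 0 ≤ M),
      mul_nonneg (by linarith : 0 ≤ M) (sq_nonneg ‖tang (s • p)‖)]
  have hℓlin : ℓ (s • p) = s * ((1 - τ) * σ + τ * ℓ w) := by
    simp only [hℓ, hσdef, hp, lastCoord_smul, lastCoord_add, tang_smul, tang_add, inner_smul_right,
      inner_add_right]
    ring
  have hlow : s * m ≤ |σ| * |ℓ (s • p)| := by
    rw [← abs_mul]
    refine le_trans ?_ (le_abs_self _)
    have : σ * ℓ (s • p) = s * ((1 - τ) * σ ^ 2 + τ * (σ * ℓ w)) := by rw [hℓlin]; ring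
    rw [this, hwℓ]
    gcongr
    have h1 : m ≤ σ ^ 2 := min_le_left _ _
    have h2 : m ≤ 1 := min_le_right _ _
    linarith [mul_le_mul_of_nonneg_left h1 (by linarith : 0 ≤ 1 - τ),
      mul_le_mul_of_nonneg_left h2 hτ0]
  have hup : |σ| * |ℓ (s • p)| ≤ |σ| * (2 * M * (s * R) ^ 2) := by
    have : 2 * M * ‖tang (s • p)‖ ^ 2 ≤ 2 * M * (s * R) ^ 2 := by gcongr
    gcongr
    exact hℓp.trans this
  have : s * m ≤ s * (s * (|σ| * (2 * M * R ^ 2))) := by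
    refine hlow.trans (hup.trans (le_of_eq ?_)); ring
  linarith [mul_lt_mul_of_pos_left hs3 hs0]

/-! ### The boundary gradient -/

/-- A convex function on a `QuadraticDomain` with Monge–Ampère measure at most `L dx`, whose
boundary values are bounded by `K` and agree at `0` to order `2 + α` with the quadratic polynomial
`u(0) + b · x' + (1/2) (A x') · x'`. -/
structure QuadraticProblem (α L M κ K ρ : ℝ) (Ω : Set (E (d + 1))) (u : E (d + 1) → ℝ)
    (b : E d) (A B : E d →L[ℝ] E d) : Prop extends QuadraticDomain α M κ ρ Ω B where
  convexOn : ConvexOn ℝ (closure Ω) u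
  continuousOn : ContinuousOn u (closure Ω)
  volume_le : ∀ S ⊆ Ω, MeasurableSet S →
    volume (⋃ x ∈ S, subdiff Ω u x) ≤ ENNReal.ofReal L * volume S
  abs_boundary_le : ∀ x ∈ frontier Ω, |u x| ≤ K
  norm_linear_le : ‖b‖ ≤ M
  norm_hessian_le : ‖A‖ ≤ M
  near_data : ∀ x ∈ frontier Ω, ‖x‖ < ρ →
    |u x - quadPoly (u 0) b A (tang x)| ≤ M * ‖tang x‖ ^ (2 + α)

namespace QuadraticProblem

variable {α L M κ K ρ : ℝ}

lemma exists_abs_sub_le (hα : 0 < α) (hM : 1 ≤ M) (hκ : 0 < κ) (hK : 0 ≤ K) (hρ : 0 < ρ) :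
    ∃ C : ℝ, 0 < C ∧ ∀ (Ω : Set (E (d + 1))) (u : E (d + 1) → ℝ) (b : E d) (A B : E d →L[ℝ] E d),
      QuadraticProblem α L M κ K ρ Ω u b A B → ∀ x ∈ frontier Ω,
        |u x - u 0 - inner ℝ b (tang x)| ≤ C * ‖x‖ ^ 2 := by
  set m := min ρ 1 with hm
  have hm0 : 0 < m := lt_min hρ one_pos
  refine ⟨2 * M + (2 * K + M * κ⁻¹) / m ^ 2, by positivity, fun Ω u b A B h x hx => ?_⟩
  have hF : 0 ≤ (2 * K + M * κ⁻¹) / m ^ 2 := by positivity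
  rcases lt_or_ge ‖x‖ m with hxm | hxm
  · have h1 := h.near_data x hx (hxm.trans_le (min_le_left _ _))
    have h2 := abs_half_inner_apply_le A h.norm_hessian_le (tang x)
    have h3 := rpow_two_add_le (norm_nonneg (tang x))
      ((norm_tang_le x).trans (hxm.le.trans (min_le_right _ _))) hα
    have h4 : ‖tang x‖ ^ 2 ≤ ‖x‖ ^ 2 := by gcongr; exact norm_tang_le x
    have h5 : u x - u 0 - inner ℝ b (tang x) = (u x - quadPoly (u 0) b A (tang x))
        + (1 / 2) * inner ℝ (A (tang x)) (tang x) := by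
      simp only [quadPoly]; ring
    rw [h5]
    have h6 := abs_add_le (u x - quadPoly (u 0) b A (tang x))
      ((1 / 2) * inner ℝ (A (tang x)) (tang x))
    have h7 := mul_le_mul_of_nonneg_left h3 (by linarith : 0 ≤ M)
    have h8 := mul_le_mul_of_nonneg_left h4 (by linarith : 0 ≤ 2 * M)
    have h9 := mul_nonneg hF (sq_nonneg ‖x‖)
    linarith [mul_nonneg (by linarith : 0 ≤ M) (sq_nonneg ‖tang x‖)]
  · have h1 := h.abs_boundary_le x hx
    have h2 := h.abs_boundary_le 0 h.zero_mem_frontier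
    have h3 : |inner ℝ b (tang x)| ≤ M * κ⁻¹ := by
      refine (abs_real_inner_le_norm b (tang x)).trans ?_
      exact mul_le_mul h.norm_linear_le
        ((norm_tang_le x).trans (h.norm_le_inv hκ hx.1)) (norm_nonneg _) (by linarith)
    have h4 : 2 * K + M * κ⁻¹ ≤ (2 * K + M * κ⁻¹) / m ^ 2 * ‖x‖ ^ 2 := by
      rw [div_mul_eq_mul_div, le_div_iff₀ (by positivity)]
      gcongr
    have h5 : |u x - u 0 - inner ℝ b (tang x)| ≤ |u x| + |u 0| + |inner ℝ b (tang x)| :=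
      (abs_sub _ _).trans (add_le_add_left (abs_sub _ _) _)
    have h6 : 0 ≤ 2 * M * ‖x‖ ^ 2 := by positivity
    linarith

/-- The lower barrier `u(0) + b · x' - N x_n + W |x|²` bounds the normal slope from below. -/
lemma exists_lower_bound (hα : 0 < α) (hL : 0 ≤ L) (hM : 1 ≤ M) (hκ : 0 < κ) (hK : 0 ≤ K)
    (hρ : 0 < ρ) :
    ∃ N : ℝ, 0 < N ∧ ∀ (Ω : Set (E (d + 1))) (u : E (d + 1) → ℝ) (b : E d) (A B : E d →L[ℝ] E d),
      QuadraticProblem α L M κ K ρ Ω u b A B → ∀ x ∈ closure Ω,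
        u 0 + inner ℝ b (tang x) - N * lastCoord x ≤ u x := by
  obtain ⟨C, hC, hbd⟩ := exists_abs_sub_le (d := d) (L := L) hα hM hκ hK hρ
  set W := L + 1 with hW
  refine ⟨(W + C) / κ, by positivity, fun Ω u b A B h => ?_⟩
  set N := (W + C) / κ with hN
  have hψ : ∀ x : E (d + 1), u 0 + inner ℝ (point b (-N)) x + ∑ i, W * x i ^ 2
      = u 0 + inner ℝ b (tang x) - N * lastCoord x + W * ‖x‖ ^ 2 := by
    intro x
    rw [inner_eq_tang_add, tang_point, lastCoord_point, ← Finset.mul_sum, EuclideanSpace.norm_sq_eq]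
    simp only [Real.norm_eq_abs, sq_abs]
    ring
  have hfr : ∀ x ∈ frontier Ω,
      u 0 + inner ℝ (point b (-N)) x + ∑ i, W * x i ^ 2 ≤ u x := by
    intro x hx
    rw [hψ]
    have h1 := (abs_le.1 (hbd Ω u b A B h x hx)).1
    have h2 : (W + C) * ‖x‖ ^ 2 ≤ N * lastCoord x := by
      have := mul_le_mul_of_nonneg_left (h.sq_le hx.1) (by positivity : 0 ≤ N)
      rwa [← mul_assoc, hN, div_mul_cancel₀ _ hκ.ne'] at this
    linarith
  have hdet : L < ∏ _i : Fin (d + 1), (2 * W) := by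
    rw [Finset.prod_const, Finset.card_univ, Fintype.card_fin]
    calc L < 2 * W := by linarith
      _ ≤ (2 * W) ^ (d + 1) := le_self_pow₀ (by linarith) (by omega)
  have hin := quadratic_le_of_le_boundary hL (h.convexOn.subset subset_closure h.convex) h.isOpen
    subset_rfl (h.isBounded hκ) h.continuousOn h.volume_le (w := fun _ => W)
    (fun _ => by positivity) hdet (u 0) (point b (-N))
    (fun x hx hxΩ => hfr x (by rw [h.isOpen.frontier_eq]; exact ⟨hx, hxΩ⟩))
  intro x hx
  have : u 0 + inner ℝ (point b (-N)) x + ∑ i, W * x i ^ 2 ≤ u x := by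
    by_cases hxΩ : x ∈ Ω
    · exact hin x hxΩ
    · exact hfr x (by rw [h.isOpen.frontier_eq]; exact ⟨hx, hxΩ⟩)
  rw [hψ] at this
  have h0 : 0 ≤ W * ‖x‖ ^ 2 := by positivity
  linarith

section

variable {Ω : Set (E (d + 1))} {u : E (d + 1) → ℝ} {b : E d} {A B : E d →L[ℝ] E d}

/-- The tangential part of a subgradient at `0` is determined by the boundary data. -/
lemma tang_eq (h : QuadraticProblem α L M κ K ρ Ω u b A B) (hα : 0 < α) (hM : 1 ≤ M)
    (hκ : 0 < κ) (hρ : 0 < ρ) {g : E (d + 1)} (hg : g ∈ subdiff (closure Ω) u 0) :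
    tang g = b := by
  obtain ⟨c, s₀, hc, hs₀, hreg⟩ := QuadraticDomain.exists_region (d := d) (κ := κ) hα hM hρ
  by_contra hne
  set e := tang g - b with he
  have he0 : 0 < ‖e‖ := norm_pos_iff.2 (sub_ne_zero.2 hne)
  -- compare `u` with its support plane at the boundary point above `s e`, with `s` small
  obtain ⟨s, hs0, hs1, hs2, hs3⟩ := exists_small_mul_lt (by positivity : 0 < c * s₀) one_pos
    (‖e‖ ^ 2) (|lastCoord g| / c + 2 * M)
  have hse : ‖s • e‖ ^ 2 = s ^ 2 * ‖e‖ ^ 2 := by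
    rw [norm_smul, Real.norm_of_nonneg hs0.le, mul_pow]
  obtain ⟨x, hx, htx, hx0, hxc, hxρ, hx1⟩ :=
    h.toQuadraticDomain.exists_frontier_point hκ hc (hreg Ω B h.toQuadraticDomain) (y := s • e)
      (by rw [hse]; nlinarith [mul_pos hs0 (pow_pos he0 2)])
  have h1 := hg x hx.1
  rw [sub_zero, inner_eq_tang_add, htx] at h1
  have h2 := (abs_le.1 (h.near_data x hx hxρ)).2
  have h3 := (abs_le.1 (abs_half_inner_apply_le A h.norm_hessian_le (tang x))).2
  have h4 := mul_le_mul_of_nonneg_left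
    (rpow_two_add_le (norm_nonneg (tang x)) ((norm_tang_le x).trans hx1) hα)
    (by linarith : 0 ≤ M)
  rw [quadPoly] at h2
  rw [htx] at h2 h3 h4
  rw [hse] at h3 h4 hxc
  have h5 : inner ℝ (tang g) (s • e) - inner ℝ b (s • e) = s * ‖e‖ ^ 2 := by
    rw [← inner_sub_left, ← he, inner_smul_right, real_inner_self_eq_norm_sq]
  have h6 : -(lastCoord g * lastCoord x) ≤ |lastCoord g| * (s ^ 2 * ‖e‖ ^ 2 / c) := by
    calc -(lastCoord g * lastCoord x) ≤ |lastCoord g * lastCoord x| := neg_le_abs _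
      _ = |lastCoord g| * lastCoord x := by rw [abs_mul, abs_of_nonneg hx0]
      _ ≤ _ := by gcongr
  have h7 : |lastCoord g| * (s ^ 2 * ‖e‖ ^ 2 / c) = s * ‖e‖ ^ 2 * (s * (|lastCoord g| / c)) := by
    ring
  have h8 : 0 < s * ‖e‖ ^ 2 := by positivity
  have h9 := mul_lt_mul_of_pos_left hs3 h8
  have h10 : 0 ≤ M * (s ^ 2 * ‖e‖ ^ 2) := by positivity
  linarith

lemma exists_gradient (h : QuadraticProblem α L M κ K ρ Ω u b A B) (hα : 0 < α) (hL : 0 ≤ L)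
    (hM : 1 ≤ M) (hκ : 0 < κ) (hK : 0 ≤ K) (hρ : 0 < ρ) :
    ∃ g, IsBoundaryGradient Ω u 0 (eLast d) g := by
  obtain ⟨N, hN, hlow⟩ := exists_lower_bound (d := d) hα hL hM hκ hK hρ
  have hmem : ∀ s : ℝ, point b s ∈ subdiff (closure Ω) u 0 ↔
      ∀ y ∈ closure Ω, u 0 + inner ℝ b (tang y) + s * lastCoord y ≤ u y := by
    intro s
    refine forall₂_congr fun y _ => ?_
    rw [sub_zero, inner_eq_tang_add, tang_point, lastCoord_point, add_assoc]
  set S : Set ℝ := {s | point b s ∈ subdiff (closure Ω) u 0} with hS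
  have hNS : -N ∈ S := by
    refine (hmem _).2 fun y hy => ?_
    linarith [hlow Ω u b A B h y hy]
  have hub : ∀ s ∈ S, ∀ y ∈ closure Ω, 0 < lastCoord y →
      s ≤ (u y - u 0 - inner ℝ b (tang y)) / lastCoord y := by
    intro s hs y hy hy0
    rw [le_div_iff₀ hy0]
    linarith [(hmem s).1 hs y hy]
  have hbdd : BddAbove S := by
    obtain ⟨z, hz⟩ := h.nonempty
    exact ⟨_, fun s hs => hub s hs z (subset_closure hz) (h.lastCoord_pos z hz)⟩
  refine ⟨point b (sSup S), (hmem _).2 fun y hy => ?_, fun ε hε hmem' => ?_⟩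
  · rcases (h.lastCoord_nonneg hκ hy).eq_or_lt with h0 | h0
    · have := (hmem _).1 hNS y hy
      rw [← h0] at this ⊢
      simpa using this
    · have := csSup_le ⟨_, hNS⟩ fun s hs => hub s hs y hy h0
      rw [le_div_iff₀ h0] at this
      linarith
  · have heq : point b (sSup S) + ε • eLast d = point b (sSup S + ε) := by
      rw [← point_tang_lastCoord (point b (sSup S) + ε • eLast d)]
      simp
    rw [heq] at hmem'
    linarith [le_csSup hbdd (show sSup S + ε ∈ S from hmem')]

end

lemma exists_abs_lastCoord_le (hα : 0 < α) (hL : 0 ≤ L) (hM : 1 ≤ M) (hκ : 0 < κ) (hK : 0 ≤ K)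
    (hρ : 0 < ρ) :
    ∃ N : ℝ, 0 < N ∧ ∀ (Ω : Set (E (d + 1))) (u : E (d + 1) → ℝ) (b : E d) (A B : E d →L[ℝ] E d),
      QuadraticProblem α L M κ K ρ Ω u b A B → ∀ g, IsBoundaryGradient Ω u 0 (eLast d) g →
        |lastCoord g| ≤ N := by
  obtain ⟨N, hN, hlow⟩ := exists_lower_bound (d := d) hα hL hM hκ hK hρ
  obtain ⟨c, s₀, hc, hs₀, hreg⟩ := QuadraticDomain.exists_region (d := d) (κ := κ) hα hM hρ
  refine ⟨max N (2 * K / s₀), by positivity, fun Ω u b A B h g hg => abs_le.2 ⟨?_, ?_⟩⟩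
  · by_contra hcon
    push Not at hcon
    have hlt : lastCoord g < -N := hcon.trans_le (neg_le_neg (le_max_left _ _))
    refine hg.2 (-N - lastCoord g) (by linarith) fun y hy => ?_
    have := hlow Ω u b A B h y hy
    rw [sub_zero, inner_eq_tang_add]
    simp only [tang_add, tang_smul, tang_eLast, smul_zero, add_zero, lastCoord_add, lastCoord_smul,
      lastCoord_eLast, h.tang_eq hα hM hκ hρ hg.1]
    linarith
  · refine le_trans ?_ (le_max_right _ _)
    have hmem := hreg Ω B h.toQuadraticDomain (s₀ • eLast d) (by simp [hs₀.le]) (by simp)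
      (by simp; positivity)
    have h1 := hg.1 _ hmem.1
    have h2 := convexOn_le_of_frontier_le (h.isBounded hκ) h.convexOn
      (fun x hx => (le_abs_self _).trans (h.abs_boundary_le x hx)) _ hmem.1
    have h3 := (abs_le.1 (h.abs_boundary_le 0 h.zero_mem_frontier)).1
    rw [sub_zero, inner_smul_right, real_inner_comm, inner_eLast] at h1
    rw [le_div_iff₀ hs₀]
    linarith

/-- Above its support plane at `0`, the function grows at most linearly in `x_n`. -/
lemma exists_sub_le_lastCoord (hα : 0 < α) (hL : 0 ≤ L) (hM : 1 ≤ M) (hκ : 0 < κ) (hK : 0 ≤ K)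
    (hρ : 0 < ρ) :
    ∃ C : ℝ, 0 < C ∧ ∀ (Ω : Set (E (d + 1))) (u : E (d + 1) → ℝ) (b : E d) (A B : E d →L[ℝ] E d),
      QuadraticProblem α L M κ K ρ Ω u b A B → ∀ g, IsBoundaryGradient Ω u 0 (eLast d) g →
        ∀ x ∈ closure Ω, u x - u 0 - inner ℝ g x ≤ C * lastCoord x := by
  obtain ⟨N, hN, hgN⟩ := exists_abs_lastCoord_le (d := d) hα hL hM hκ hK hρ
  obtain ⟨C, hC, hbd⟩ := exists_abs_sub_le (d := d) (L := L) hα hM hκ hK hρ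
  refine ⟨C / κ + N, by positivity, fun Ω u b A B h g hg => ?_⟩
  have hconv : ConvexOn ℝ (closure Ω)
      (fun x => u x - inner ℝ (g + (C / κ + N) • eLast d) x) :=
    h.convexOn.sub ((innerₛₗ ℝ _).concaveOn h.convexOn.1)
  have hsplit : ∀ x : E (d + 1), inner ℝ (g + (C / κ + N) • eLast d) x
      = inner ℝ g x + (C / κ + N) * lastCoord x := by
    intro x
    rw [inner_add_left, real_inner_smul_left, inner_eLast]
  intro x hx
  have := convexOn_le_of_frontier_le (h.isBounded hκ) hconv (c := u 0) (fun y hy => ?_) x hx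
  · rw [hsplit] at this
    linarith
  · rw [hsplit, inner_eq_tang_add, h.tang_eq hα hM hκ hρ hg.1]
    have h1 := (abs_le.1 (hbd Ω u b A B h y hy)).2
    have h2 : C * ‖y‖ ^ 2 ≤ C / κ * lastCoord y := by
      have := mul_le_mul_of_nonneg_left (h.sq_le hy.1) (by positivity : 0 ≤ C / κ)
      rwa [← mul_assoc, div_mul_cancel₀ _ hκ.ne'] at this
    have h3 := mul_le_mul_of_nonneg_right (abs_le.1 (hgN Ω u b A B h g hg)).1
      (h.lastCoord_nonneg hκ hy.1)
    linarith

end QuadraticProblem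

/-! ### Decay of the normal slope -/

namespace QuadraticProblem

variable {α L M κ K ρ : ℝ}

section

variable {Ω : Set (E (d + 1))} {u : E (d + 1) → ℝ} {b : E d} {A B : E d →L[ℝ] E d}
  {g : E (d + 1)}

lemma sub_smul_le (h : QuadraticProblem α L M κ K ρ Ω u b A B) {x : E (d + 1)}
    (hx : x ∈ closure Ω) {t : ℝ} (ht0 : 0 ≤ t) (ht1 : t ≤ 1) :
    u (t • x) - u 0 - inner ℝ g (t • x) ≤ t * (u x - u 0 - inner ℝ g x) := by
  have := h.convexOn.2 h.zero_mem hx (sub_nonneg.2 ht1) ht0 (by ring)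
  simp only [smul_zero, zero_add, smul_eq_mul] at this
  rw [inner_smul_right]
  linarith

lemma sub_nonneg_of_isBoundaryGradient {ν : E (d + 1)} (hg : IsBoundaryGradient Ω u 0 ν g)
    {x : E (d + 1)} (hx : x ∈ closure Ω) : 0 ≤ u x - u 0 - inner ℝ g x := by
  have := hg.1 x hx
  rw [sub_zero] at this
  linarith

/-- At a boundary point near `0`, the height above the support plane is a quadratic form in `x'`,
up to an error of order `2 + α`. -/
lemma abs_sub_quadratic_le (h : QuadraticProblem α L M κ K ρ Ω u b A B)
    (hgb : tang g = b) {N : ℝ} (hgN : |lastCoord g| ≤ N) {x : E (d + 1)} (hx : x ∈ frontier Ω)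
    (hxρ : ‖x‖ < ρ) :
    |u x - u 0 - inner ℝ g x - ((1 / 2) * inner ℝ (A (tang x)) (tang x)
      - lastCoord g * ((1 / 2) * inner ℝ (B (tang x)) (tang x)))|
      ≤ M * (1 + N) * ‖tang x‖ ^ (2 + α) := by
  have h1 := h.near_data x hx hxρ
  have h2 := h.near x hx hxρ
  have h3 : u x - u 0 - inner ℝ g x - ((1 / 2) * inner ℝ (A (tang x)) (tang x)
      - lastCoord g * ((1 / 2) * inner ℝ (B (tang x)) (tang x)))
      = (u x - quadPoly (u 0) b A (tang x))
        - lastCoord g * (lastCoord x - (1 / 2) * inner ℝ (B (tang x)) (tang x)) := by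
    rw [inner_eq_tang_add, hgb, quadPoly]; ring
  rw [h3]
  refine (abs_sub _ _).trans ?_
  rw [abs_mul]
  have h4 := mul_le_mul hgN h2 (abs_nonneg _) ((abs_nonneg _).trans hgN)
  linarith

/-- The barrier step: lower bounds of order `a` on the boundary and on the slice `x_n = t`
propagate to the whole domain if `a ^ (d + 1)` dominates `t`. -/
lemma lastCoord_le_of_slice (h : QuadraticProblem α L M κ K ρ Ω u b A B) (hL : 0 ≤ L)
    (hκ : 0 < κ) {a t : ℝ} (ha : 0 < a) (ht : 0 < t)
    (hdet : L < (a * κ / 8) ^ d * (a / (4 * t)))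
    (hslice : ∀ x ∈ closure Ω, lastCoord x = t → a * t ≤ u x - u 0 - inner ℝ g x)
    (hfr : ∀ x ∈ frontier Ω, lastCoord x ≤ t →
      a / 4 * lastCoord x ≤ u x - u 0 - inner ℝ g x) :
    ∀ x ∈ closure Ω, a / 16 * lastCoord x ≤ u x - u 0 - inner ℝ g x := by
  set w : Fin (d + 1) → ℝ := Fin.snoc (α := fun _ => ℝ) (fun _ => a * κ / 16) (a / (8 * t)) with hw
  have hw0 : ∀ i, 0 ≤ w i := by
    intro i
    refine Fin.lastCases ?_ (fun j => ?_) i <;> simp only [hw, Fin.snoc_last, Fin.snoc_castSucc] <;>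
      positivity
  have hprod : ∏ i, (2 * w i) = (a * κ / 8) ^ d * (a / (4 * t)) := by
    rw [Fin.prod_univ_castSucc]
    simp only [hw, Fin.snoc_last, Fin.snoc_castSucc, Finset.prod_const, Finset.card_univ,
      Fintype.card_fin]
    congr 1
    · congr 1; ring
    · field_simp; norm_num
  have hψ : ∀ x : E (d + 1), u 0 + inner ℝ (g + (a / 16) • eLast d) x + ∑ i, w i * x i ^ 2
      = u 0 + inner ℝ g x + (a / 16 * lastCoord x + a * κ / 16 * ‖tang x‖ ^ 2
        + a / (8 * t) * lastCoord x ^ 2) := by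
    intro x
    rw [inner_add_left, real_inner_smul_left, inner_eLast, Fin.sum_univ_castSucc,
      EuclideanSpace.norm_sq_eq]
    simp only [hw, Fin.snoc_last, Fin.snoc_castSucc, ← Finset.mul_sum, Real.norm_eq_abs, sq_abs,
      tang, lastCoord]
    ring
  -- on the closure of the part below height `t` the barrier is at most `(a / 4) x_n`
  have hbar : ∀ x ∈ closure Ω, lastCoord x ≤ t →
      a / 16 * lastCoord x + a * κ / 16 * ‖tang x‖ ^ 2 + a / (8 * t) * lastCoord x ^ 2
        ≤ a / 4 * lastCoord x := by
    intro x hx hxt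
    have hx0 := h.lastCoord_nonneg hκ hx
    have h1 : a * κ / 16 * ‖tang x‖ ^ 2 ≤ a / 16 * lastCoord x := by
      have h2 : ‖tang x‖ ^ 2 ≤ ‖x‖ ^ 2 := by gcongr; exact norm_tang_le x
      have h3 := mul_le_mul_of_nonneg_left h2 hκ.le
      have h4 := mul_le_mul_of_nonneg_left (h3.trans (h.sq_le hx)) (by positivity : 0 ≤ a / 16)
      linarith
    have h2 : a / (8 * t) * lastCoord x ^ 2 ≤ a / 8 * lastCoord x := by
      have h3 : a / (8 * t) * lastCoord x ^ 2 ≤ a / (8 * t) * (t * lastCoord x) := by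
        rw [sq]; gcongr
      have h4 : a / (8 * t) * (t * lastCoord x) = a / 8 * lastCoord x := by
        field_simp
      linarith
    linarith
  set D : Set (E (d + 1)) := Ω ∩ {x | lastCoord x < t} with hD
  have hDo : IsOpen D := h.isOpen.inter (isOpen_lt continuous_lastCoord continuous_const)
  have hDcl : closure D ⊆ closure Ω := closure_mono inter_subset_left
  have hDt : ∀ x ∈ closure D, lastCoord x ≤ t := fun x hx =>
    closure_minimal (fun y hy => le_of_lt hy.2)
      (isClosed_le continuous_lastCoord continuous_const) hx
  have hin := quadratic_le_of_le_boundary hL (h.convexOn.subset subset_closure h.convex) hDo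
    inter_subset_left ((h.isBounded hκ).subset inter_subset_left) (h.continuousOn.mono hDcl)
    h.volume_le hw0 (hdet.trans_eq hprod.symm) (u 0) (g + (a / 16) • eLast d)
    (fun x hx hxD => by
      rw [hψ]
      have hb := hbar x (hDcl hx) (hDt x hx)
      by_cases hxΩ : x ∈ Ω
      · have hxt : lastCoord x = t :=
          le_antisymm (hDt x hx) (not_lt.1 fun hlt => hxD ⟨hxΩ, hlt⟩)
        have h1 := hslice x (hDcl hx) hxt
        rw [hxt] at hb ⊢
        have : 0 < a * t := by positivity
        linarith
      · have h1 := hfr x (by rw [h.isOpen.frontier_eq]; exact ⟨hDcl hx, hxΩ⟩) (hDt x hx)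
        linarith)
  intro x hx
  have hx0 := h.lastCoord_nonneg hκ hx
  have hax : 0 ≤ a * lastCoord x := by positivity
  rcases lt_or_ge (lastCoord x) t with hxt | hxt
  · by_cases hxΩ : x ∈ Ω
    · have h1 := hin x ⟨hxΩ, hxt⟩
      rw [hψ] at h1
      have : 0 ≤ a * κ / 16 * ‖tang x‖ ^ 2 + a / (8 * t) * lastCoord x ^ 2 := by positivity
      linarith
    · have h1 := hfr x (by rw [h.isOpen.frontier_eq]; exact ⟨hx, hxΩ⟩) hxt.le
      linarith
  · have hx0' : 0 < lastCoord x := ht.trans_le hxt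
    have hle : t / lastCoord x ≤ 1 := by rwa [div_le_one hx0']
    have h1 := hslice _ (h.smul_mem hx (by positivity) hle)
      (by rw [lastCoord_smul]; field_simp)
    have h2 := h1.trans (h.sub_smul_le hx (by positivity) hle)
    rw [div_mul_eq_mul_div, le_div_iff₀ hx0'] at h2
    have h3 : t * (a * lastCoord x) ≤ t * (u x - u 0 - inner ℝ g x) := by linarith
    have h4 := le_of_mul_le_mul_left h3 ht
    linarith

end

/-- A lower bound `a t` on the slice `x_n = t` forces a lower bound `(a / 4) x_n` at all boundary
points below it. The boundary data are a quadratic form up to a small error, so a boundary point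
violating the bound could be blown up along the boundary to one of height comparable to `t`, and
from there scaled back to a point of the slice. -/
lemma exists_frontier_lower_bound (hα : 0 < α) (hL : 0 ≤ L) (hM : 1 ≤ M) (hκ : 0 < κ)
    (hK : 0 ≤ K) (hρ : 0 < ρ) :
    ∃ t₀ C : ℝ, 0 < t₀ ∧ t₀ ≤ 1 ∧ 0 < C ∧
      ∀ (Ω : Set (E (d + 1))) (u : E (d + 1) → ℝ) (b : E d) (A B : E d →L[ℝ] E d),
      QuadraticProblem α L M κ K ρ Ω u b A B → ∀ g, IsBoundaryGradient Ω u 0 (eLast d) g →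
      ∀ t a : ℝ, 0 < t → t ≤ t₀ → 0 < a → C * t ^ (α / 2) ≤ a →
        (∀ x ∈ closure Ω, lastCoord x = t → a * t ≤ u x - u 0 - inner ℝ g x) →
        ∀ y ∈ frontier Ω, lastCoord y ≤ t → a / 4 * lastCoord y ≤ u y - u 0 - inner ℝ g y := by
  obtain ⟨N, hN, hgN⟩ := exists_abs_lastCoord_le (d := d) hα hL hM hκ hK hρ
  obtain ⟨c, s₀, hc, hs₀, hreg⟩ := QuadraticDomain.exists_region (d := d) (κ := κ) hα hM hρ
  set m := min ρ 1 with hm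
  have hm0 : 0 < m := lt_min hρ one_pos
  have hmρ : m ≤ ρ := min_le_left _ _
  have hm1 : m ≤ 1 := min_le_right _ _
  -- for `t ≤ t₁` the error term `2 M R ^ (2 + α)`, with `R = (t / κ)^(1/2)`, is at most `t`
  set t₁ := κ * (κ / (2 * M)) ^ (2 / α) with ht₁
  have ht₁0 : 0 < t₁ := by positivity
  refine ⟨min (min 1 t₁) (min (κ * (m / 2) ^ 2) (κ * (c * s₀))),
    8 * (M * (1 + N)) * κ⁻¹ ^ (α / 2) / κ, by positivity,
    (min_le_left _ _).trans (min_le_left _ _), by positivity,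
    fun Ω u b A B h g hg t a ht ht₀ ha hCa hslice y hy hyt => ?_⟩
  have htt₁ : t ≤ t₁ := ht₀.trans ((min_le_left _ _).trans (min_le_right _ _))
  have htm : t ≤ κ * (m / 2) ^ 2 := ht₀.trans ((min_le_right _ _).trans (min_le_left _ _))
  have htc : t ≤ κ * (c * s₀) := ht₀.trans ((min_le_right _ _).trans (min_le_right _ _))
  have hgb := h.tang_eq hα hM hκ hρ hg.1
  have hgN' := hgN Ω u b A B h g hg
  have hv0 : 0 ≤ u y - u 0 - inner ℝ g y := sub_nonneg_of_isBoundaryGradient hg hy.1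
  rcases le_or_gt (lastCoord y) 0 with hy0 | hy0
  · exact (mul_nonpos_of_nonneg_of_nonpos (by positivity) hy0).trans hv0
  by_contra hcon
  push Not at hcon
  have hyκ := h.sq_le hy.1
  have hym : ‖y‖ ≤ m / 2 := by
    refine abs_le_of_sq_le_sq' ?_ (by positivity) |>.2
    exact le_of_mul_le_mul_left (hyκ.trans (hyt.trans htm)) hκ
  have hyT : 0 < ‖tang y‖ := by
    rcases (norm_nonneg (tang y)).eq_or_lt with h0 | h0
    · have := h.lastCoord_le hα hM hy (by linarith) (by linarith)
      rw [← h0] at this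
      norm_num at this
      linarith
    · exact h0
  -- the boundary point `z` over the rescaling of `y'` to length `R = (t / κ)^(1/2)`
  set R := Real.sqrt (t / κ) with hR
  have hR0 : 0 < R := Real.sqrt_pos.2 (by positivity)
  have hR2 : R ^ 2 = t / κ := Real.sq_sqrt (by positivity)
  have hRα : R ^ α = t ^ (α / 2) * κ⁻¹ ^ (α / 2) := by
    rw [hR, Real.sqrt_eq_rpow, ← Real.rpow_mul (by positivity), div_eq_mul_inv,
      Real.mul_rpow ht.le (by positivity)]
    congr 2 <;> ring
  have hRM : 2 * M * R ^ α ≤ κ := by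
    have h1 : t / κ ≤ (κ / (2 * M)) ^ (2 / α) := by
      rw [div_le_iff₀ hκ, mul_comm]; exact htt₁
    have h2 : R ^ α ≤ κ / (2 * M) := by
      rw [hR, Real.sqrt_eq_rpow, ← Real.rpow_mul (by positivity)]
      refine (Real.rpow_le_rpow (by positivity) h1 (by positivity)).trans (le_of_eq ?_)
      rw [← Real.rpow_mul (by positivity), show 2 / α * (1 / 2 * α) = 1 by field_simp,
        Real.rpow_one]
    rw [le_div_iff₀ (by positivity)] at h2
    linarith
  set μ := R / ‖tang y‖ with hμ
  have hμ0 : 0 < μ := by positivity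
  have hyR : ‖tang y‖ ≤ R := by
    refine abs_le_of_sq_le_sq' ?_ hR0.le |>.2
    rw [hR2, le_div_iff₀ hκ]
    have : ‖tang y‖ ^ 2 ≤ ‖y‖ ^ 2 := by gcongr; exact norm_tang_le y
    linarith [mul_le_mul_of_nonneg_left this hκ.le]
  have hμy : ‖μ • tang y‖ = R := by
    rw [norm_smul, Real.norm_of_nonneg hμ0.le, hμ, div_mul_cancel₀ _ hyT.ne']
  obtain ⟨z, hz, hzT, hz0, -, hzρ, hz1⟩ :=
    h.toQuadraticDomain.exists_frontier_point hκ hc (hreg Ω B h.toQuadraticDomain) (y := μ • tang y)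
      (by rw [hμy, hR2, div_le_iff₀ hκ]; linarith)
  have hzt : t ≤ lastCoord z := by
    have h1 := h.sq_le hz.1
    have h2 : R ^ 2 ≤ ‖z‖ ^ 2 := by
      rw [← hμy, ← hzT]; gcongr; exact norm_tang_le z
    have h3 := mul_le_mul_of_nonneg_left h2 hκ.le
    rw [hR2, mul_div_cancel₀ _ hκ.ne'] at h3
    linarith
  have hz0' : 0 < lastCoord z := ht.trans_le hzt
  have ey := h.abs_sub_quadratic_le hgb hgN' hy (by linarith)
  have ez := h.abs_sub_quadratic_le hgb hgN' hz hzρ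
  have qy := h.near y hy (by linarith)
  have qz := h.near z hz hzρ
  rw [hzT, hμy] at ez qz
  simp only [map_smul, real_inner_smul_left, inner_smul_right] at ez qz
  set p := inner ℝ (A (tang y)) (tang y)
  set q := inner ℝ (B (tang y)) (tang y)
  set vy := u y - u 0 - inner ℝ g y
  set vz := u z - u 0 - inner ℝ g z with hvz
  set ey' := ‖tang y‖ ^ (2 + α) with hey'
  set E' := R ^ (2 + α) with hE'
  have hE : μ ^ 2 * ey' ≤ E' := by
    rw [hey', hE', rpow_two_add (norm_nonneg _) hα, rpow_two_add hR0.le hα, hμ, div_pow,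
      ← mul_assoc, div_mul_cancel₀ _ (by positivity)]
    gcongr
  have hμ2 : 0 ≤ μ ^ 2 := sq_nonneg _
  have hMN : 0 ≤ M * (1 + N) := by positivity
  have e1 : vz ≤ μ ^ 2 * (a / 4 * lastCoord y) + 2 * (M * (1 + N)) * E' := by
    have h1 := (abs_le.1 ez).2
    have h2 := mul_le_mul_of_nonneg_left (abs_le.1 ey).1 hμ2
    have h3 := mul_le_mul_of_nonneg_left hcon.le hμ2
    have h4 := mul_le_mul_of_nonneg_left hE hMN
    linarith
  have e2 : μ ^ 2 * lastCoord y ≤ lastCoord z + 2 * M * E' := by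
    have h1 := (abs_le.1 qz).1
    have h2 := mul_le_mul_of_nonneg_left (abs_le.1 qy).2 hμ2
    have h4 := mul_le_mul_of_nonneg_left hE (by linarith : 0 ≤ M)
    linarith
  have e3 : κ * E' ≤ lastCoord z * R ^ α := by
    rw [hE', rpow_two_add hR0.le hα, hR2, ← mul_assoc, mul_div_cancel₀ _ hκ.ne']
    gcongr
  have e4 : 2 * M * E' ≤ lastCoord z := by
    have h1 := mul_le_mul_of_nonneg_left e3 (by linarith : 0 ≤ 2 * M)
    have h2 := mul_le_mul_of_nonneg_left hRM hz0
    exact le_of_mul_le_mul_left (by linarith : κ * (2 * M * E') ≤ κ * lastCoord z) hκ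
  have e5 : 2 * (M * (1 + N)) * E' ≤ a / 4 * lastCoord z := by
    have h1 := mul_le_mul_of_nonneg_left e3 (by linarith : 0 ≤ 2 * (M * (1 + N)))
    have h2 : 8 * (M * (1 + N)) * R ^ α ≤ κ * a := by
      have := mul_le_mul_of_nonneg_left hCa hκ.le
      rw [hRα]
      refine le_trans (le_of_eq ?_) this
      field_simp
    have h3 := mul_le_mul_of_nonneg_left h2 hz0
    exact le_of_mul_le_mul_left
      (by linarith : κ * (2 * (M * (1 + N)) * E') ≤ κ * (a / 4 * lastCoord z)) hκ
  have e6 : vz ≤ 3 / 4 * (a * lastCoord z) := by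
    have := mul_le_mul_of_nonneg_left e2 (by positivity : 0 ≤ a / 4)
    have h2 := mul_le_mul_of_nonneg_left e4 (by positivity : 0 ≤ a / 4)
    linarith
  have hle : t / lastCoord z ≤ 1 := by rwa [div_le_one hz0']
  have h1 := hslice _ (h.smul_mem hz.1 (by positivity) hle) (by rw [lastCoord_smul]; field_simp)
  have h2 := h1.trans (h.sub_smul_le hz.1 (by positivity) hle)
  rw [← hvz, div_mul_eq_mul_div, le_div_iff₀ hz0'] at h2
  have h3 := mul_le_mul_of_nonneg_left e6 ht.le
  have h4 : 0 < a * t * lastCoord z := by positivity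
  linarith

/-- The minimal slope above the support plane at height `t` decays like a power of `t`: otherwise
`exists_frontier_lower_bound` and the barrier of `lastCoord_le_of_slice` contradict the maximality
of the normal slope of the boundary gradient. -/
theorem exists_slope_decay (hα : 0 < α) (hα1 : α ≤ 1) (hL : 0 ≤ L) (hM : 1 ≤ M) (hκ : 0 < κ)
    (hK : 0 ≤ K) (hρ : 0 < ρ) :
    ∃ t₀ C : ℝ, 0 < t₀ ∧ t₀ ≤ 1 ∧ 0 < C ∧
      ∀ (Ω : Set (E (d + 1))) (u : E (d + 1) → ℝ) (b : E d) (A B : E d →L[ℝ] E d),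
      QuadraticProblem α L M κ K ρ Ω u b A B → ∀ g, IsBoundaryGradient Ω u 0 (eLast d) g →
      ∀ t : ℝ, 0 < t → t ≤ t₀ → ∃ x ∈ closure Ω, lastCoord x = t ∧
        u x - u 0 - inner ℝ g x ≤ C * t ^ (α / (2 * ((d : ℝ) + 1))) * t := by
  obtain ⟨t₀, C, ht₀, ht₀1, hC, hfr⟩ := exists_frontier_lower_bound (d := d) hα hL hM hκ hK hρ
  set δ := α / (2 * ((d : ℝ) + 1)) with hδ
  set cκ := (κ / 8) ^ d / 4 with hcκ
  have hcκ0 : 0 < cκ := by positivity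
  have hd0 : (0 : ℝ) ≤ d := Nat.cast_nonneg d
  -- `A₀` makes `a = A₀ t ^ δ` satisfy both `C t ^ (α / 2) ≤ a` and the determinant condition
  set A₀ := 1 + C + (L + 1) / cκ with hA₀
  have hLc : 0 < (L + 1) / cκ := by positivity
  have hA₀1 : 1 ≤ A₀ := by linarith
  refine ⟨t₀, A₀, ht₀, ht₀1, by linarith, fun Ω u b A B h g hg t ht htt₀ => ?_⟩
  by_contra hcon
  push Not at hcon
  have ht1 : t ≤ 1 := htt₀.trans ht₀1
  set a := A₀ * t ^ δ with ha
  have htδ : 0 < t ^ δ := Real.rpow_pos_of_pos ht _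
  have ha0 : 0 < a := by positivity
  have hslice : ∀ x ∈ closure Ω, lastCoord x = t → a * t ≤ u x - u 0 - inner ℝ g x :=
    fun x hx hxt => (hcon x hx hxt).le
  have hCa : C * t ^ (α / 2) ≤ a := by
    have h1 : t ^ (α / 2) ≤ t ^ δ := by
      refine Real.rpow_le_rpow_of_exponent_ge ht ht1 ?_
      rw [hδ]
      exact div_le_div_of_nonneg_left hα.le (by norm_num) (by linarith)
    have h2 : C ≤ A₀ := by linarith
    exact mul_le_mul h2 h1 (by positivity) (by linarith)
  have hdet : L < (a * κ / 8) ^ d * (a / (4 * t)) := by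
    have h1 : (a * κ / 8) ^ d * (a / (4 * t)) = A₀ ^ (d + 1) * cκ * ((t ^ δ) ^ (d + 1) / t) := by
      rw [ha, hcκ, mul_div_assoc, mul_pow, mul_pow]
      field_simp
      ring
    have h2 : 1 ≤ (t ^ δ) ^ (d + 1) / t := by
      rw [le_div_iff₀ ht, one_mul, ← Real.rpow_natCast, ← Real.rpow_mul ht.le]
      have h3 : δ * ((d + 1 : ℕ) : ℝ) ≤ 1 := by
        rw [hδ]; push_cast
        rw [show α / (2 * ((d : ℝ) + 1)) * ((d : ℝ) + 1) = α / 2 by field_simp]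
        linarith
      simpa using Real.rpow_le_rpow_of_exponent_ge ht ht1 h3
    have h3 : A₀ ≤ A₀ ^ (d + 1) := le_self_pow₀ hA₀1 (by omega)
    have h4 : L + 1 ≤ A₀ * cκ := by
      rw [← div_le_iff₀ hcκ0]; linarith
    rw [h1]
    calc L < A₀ * cκ := by linarith
      _ ≤ A₀ ^ (d + 1) * cκ := by gcongr
      _ ≤ A₀ ^ (d + 1) * cκ * ((t ^ δ) ^ (d + 1) / t) :=
        le_mul_of_one_le_right (by positivity) h2
  have hlow := h.lastCoord_le_of_slice hL hκ ha0 ht hdet hslice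
    (hfr Ω u b A B h g hg t a ht htt₀ ha0 hCa hslice)
  refine hg.2 (a / 16) (by positivity) fun x hx => ?_
  have := hlow x hx
  rw [sub_zero, inner_add_left, real_inner_smul_left, inner_eLast]
  linarith

/-! ### The pointwise estimate -/

/-- A point `x` with `|x| = r` lies on a horizontal segment joining a point of the segment from `0`
to the low point at height `r^(1/2)` given by `exists_slope_decay` to a point of the domain much
farther away; convexity turns the decay of the slope into an estimate at `x`. -/
theorem exists_sub_le_rpow (hα : 0 < α) (hα1 : α ≤ 1) (hL : 0 ≤ L) (hM : 1 ≤ M) (hκ : 0 < κ)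
    (hK : 0 ≤ K) (hρ : 0 < ρ) :
    ∃ C : ℝ, 0 < C ∧
      ∀ (Ω : Set (E (d + 1))) (u : E (d + 1) → ℝ) (b : E d) (A B : E d →L[ℝ] E d),
      QuadraticProblem α L M κ K ρ Ω u b A B → ∀ g, IsBoundaryGradient Ω u 0 (eLast d) g →
      ∀ x ∈ closure Ω,
        u x - u 0 - inner ℝ g x ≤ C * ‖x‖ ^ (1 + α / (4 * ((d : ℝ) + 1))) := by
  obtain ⟨t₀, C₀, ht₀, ht₀1, hC₀, hdec⟩ :=
    exists_slope_decay (d := d) hα hα1 hL hM hκ hK hρ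
  obtain ⟨C₁, hC₁, hlin⟩ := exists_sub_le_lastCoord (d := d) hα hL hM hκ hK hρ
  obtain ⟨c, s₀, hc, hs₀, hreg⟩ := QuadraticDomain.exists_region (d := d) (κ := κ) hα hM hρ
  set η := α / (4 * ((d : ℝ) + 1)) with hη
  have hd0 : (0 : ℝ) ≤ d := Nat.cast_nonneg d
  have hη0 : 0 < η := by positivity
  have hη4 : η ≤ 1 / 4 := by
    rw [hη, div_le_div_iff₀ (by positivity) (by norm_num)]
    linarith
  set r₀ := min (min 1 s₀) (t₀ ^ 2) with hr₀
  have hr₀0 : 0 < r₀ := by positivity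
  set k := (Real.sqrt κ)⁻¹ with hk
  have hk0 : 0 < k := by positivity
  have hk2 : k ^ 2 * κ = 1 := by
    rw [hk, inv_pow, Real.sq_sqrt hκ.le, inv_mul_cancel₀ hκ.ne']
  set C₂ := 2 * (1 + k) / Real.sqrt c with hC₂
  have hC₂0 : 0 < C₂ := by positivity
  refine ⟨C₁ / r₀ ^ η + (C₀ + C₁ * C₂), by positivity, fun Ω u b A B h g hg x hx => ?_⟩
  set r := ‖x‖ with hr
  have hr0 : 0 ≤ r := norm_nonneg x
  have hsr : lastCoord x ≤ r := (le_abs_self _).trans (abs_lastCoord_le x)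
  rw [Real.rpow_add' hr0 (by positivity), Real.rpow_one]
  have hv1 := hlin Ω u b A B h g hg x hx
  rcases lt_or_ge r r₀ with hrr | hrr
  swap
  · have h1 : r₀ ^ η ≤ r ^ η := Real.rpow_le_rpow hr₀0.le hrr hη0.le
    have h2 : C₁ * r ≤ C₁ / r₀ ^ η * (r * r ^ η) := by
      rw [div_mul_eq_mul_div, le_div_iff₀ (by positivity), ← mul_assoc]
      gcongr
    have h3 : 0 ≤ (C₀ + C₁ * C₂) * (r * r ^ η) := by positivity
    have h4 := mul_le_mul_of_nonneg_left hsr hC₁.le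
    linarith
  rcases hr0.eq_or_lt with h0 | hr0'
  · rw [← h0] at hsr ⊢
    have := mul_le_mul_of_nonneg_left hsr hC₁.le
    simp only [zero_mul, mul_zero] at this ⊢
    linarith
  have hr1 : r ≤ 1 := hrr.le.trans ((min_le_left _ _).trans (min_le_left _ _))
  have hrs₀ : r ≤ s₀ := hrr.le.trans ((min_le_left _ _).trans (min_le_right _ _))
  have hrt₀ : r ≤ t₀ ^ 2 := hrr.le.trans (min_le_right _ _)
  set t := Real.sqrt r with ht
  have ht0 : 0 < t := Real.sqrt_pos.2 hr0'
  have ht2 : t ^ 2 = r := Real.sq_sqrt hr0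
  have htt₀ : t ≤ t₀ := Real.sqrt_le_iff.2 ⟨ht₀.le, hrt₀⟩
  have ht1 : t ≤ 1 := htt₀.trans ht₀1
  -- all lengths are compared in terms of `τ = r ^ (1 / 4)`: `t = τ ^ 2`, `|z| ≤ k τ`, `s ≤ τ ^ 4`
  set τ := Real.sqrt t with hτ
  have hτ0 : 0 < τ := Real.sqrt_pos.2 ht0
  have hτ2 : τ ^ 2 = t := Real.sq_sqrt ht0.le
  have hτ1 : τ ≤ 1 := Real.sqrt_le_iff.2 ⟨zero_le_one, by simpa using ht1⟩
  have hτ4 : τ ^ 4 = r := by rw [← ht2, ← hτ2]; ring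
  set s := lastCoord x with hs
  have hs0 : 0 < s := by
    have h1 := h.sq_le hx
    have : 0 < κ * ‖x‖ ^ 2 := by positivity
    linarith
  set σ := Real.sqrt s with hσ
  have hσ0 : 0 < σ := Real.sqrt_pos.2 hs0
  have hσ2 : σ ^ 2 = s := Real.sq_sqrt hs0.le
  have hστ : σ ≤ τ ^ 2 := by
    refine abs_le_of_sq_le_sq' ?_ (by positivity) |>.2
    rw [hσ2, hτ2, ht2]; exact hsr
  obtain ⟨z, hz, hzt, hvz⟩ := hdec Ω u b A B h g hg t ht0 htt₀
  have hst : s / t ≤ 1 := by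
    rw [div_le_one ht0]
    nlinarith
  have hzn : ‖z‖ ≤ k * τ := by
    refine abs_le_of_sq_le_sq' ?_ (by positivity) |>.2
    have h1 := h.sq_le hz
    rw [hzt] at h1
    rw [mul_pow, hτ2]
    calc ‖z‖ ^ 2 = k ^ 2 * (κ * ‖z‖ ^ 2) := by rw [← mul_assoc, hk2, one_mul]
      _ ≤ k ^ 2 * t := by gcongr
  set xh := (s / t) • z with hxh
  have hxhm : xh ∈ closure Ω := h.smul_mem hz (by positivity) hst
  have hxhl : lastCoord xh = s := by
    rw [hxh, lastCoord_smul, hzt, div_mul_cancel₀ _ ht0.ne']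
  have hxhn : ‖xh‖ ≤ k * s / τ := by
    rw [hxh, norm_smul, Real.norm_of_nonneg (by positivity)]
    calc s / t * ‖z‖ ≤ s / t * (k * τ) := by gcongr
      _ = k * s / τ := by rw [← hτ2]; field_simp
  have hvxh : u xh - u 0 - inner ℝ g xh ≤ C₀ * (r * r ^ η) := by
    have h1 := h.sub_smul_le (g := g) hz (by positivity : 0 ≤ s / t) hst
    have h2 := mul_le_mul_of_nonneg_left hvz (by positivity : 0 ≤ s / t)
    have h3 : t ^ (α / (2 * ((d : ℝ) + 1))) = r ^ η := by
      rw [ht, Real.sqrt_eq_rpow, ← Real.rpow_mul hr0, hη]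
      congr 1; field_simp; norm_num
    rw [h3] at h2
    have h4 : s / t * (C₀ * r ^ η * t) = C₀ * (s * r ^ η) := by field_simp
    have h5 : C₀ * (s * r ^ η) ≤ C₀ * (r * r ^ η) := by gcongr
    linarith
  clear_value xh
  -- `x = (1 - θ) xh + θ y` with `y` at height `s` in the region of `exists_region` when `θ < 1`
  set θ := 2 * (r + k * s / τ) / (Real.sqrt c * σ) with hθ
  have hsc : 0 < Real.sqrt c := Real.sqrt_pos.2 hc
  have hθ0 : 0 < θ := by positivity
  have hθs : θ * s ≤ C₂ * (r * r ^ η) := by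
    have h1 : θ * s = 2 / Real.sqrt c * (σ * (τ ^ 4 + k * σ ^ 2 / τ)) := by
      rw [hθ, hτ4, hσ2]
      nth_rewrite 2 [← hσ2]
      field_simp
    have h2 : σ * (τ ^ 4 + k * σ ^ 2 / τ) ≤ τ ^ 2 * (τ ^ 4 + k * (τ ^ 2) ^ 2 / τ) := by
      gcongr
    have h3 : τ ^ 2 * (τ ^ 4 + k * (τ ^ 2) ^ 2 / τ) = τ ^ 5 * (τ + k) := by
      field_simp
    have h4 : τ ^ 5 * (τ + k) ≤ τ ^ 5 * (1 + k) := by gcongr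
    have h5 : τ ≤ r ^ η := by
      have : τ = r ^ (1 / 4 : ℝ) := by
        rw [hτ, ht, Real.sqrt_eq_rpow, Real.sqrt_eq_rpow, ← Real.rpow_mul hr0]
        norm_num
      rw [this]
      exact Real.rpow_le_rpow_of_exponent_ge hr0' hr1 hη4
    have h6 : τ ^ 5 ≤ r * r ^ η := by
      calc τ ^ 5 = r * τ := by rw [← hτ4]; ring
        _ ≤ r * r ^ η := by gcongr
    calc θ * s ≤ 2 / Real.sqrt c * (τ ^ 5 * (1 + k)) := by
          rw [h1]
          exact mul_le_mul_of_nonneg_left (h2.trans (h3.le.trans h4)) (by positivity)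
      _ = C₂ * τ ^ 5 := by rw [hC₂]; ring
      _ ≤ C₂ * (r * r ^ η) := by gcongr
  have hmain : u x - u 0 - inner ℝ g x ≤ C₀ * (r * r ^ η) + C₁ * (θ * s) := by
    rcases le_or_gt 1 θ with hθ1 | hθ1
    · have h1 : s ≤ θ * s := le_mul_of_one_le_left hs0.le hθ1
      have h2 := mul_le_mul_of_nonneg_left h1 hC₁.le
      have h3 : 0 ≤ C₀ * (r * r ^ η) := by positivity
      linarith
    · set y := xh + θ⁻¹ • (x - xh) with hy
      have hyl : lastCoord y = s := by
        simp [hy, hxhl, ← hs]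
      have hθeq : θ * (Real.sqrt c * σ) = 2 * (r + k * s / τ) := by
        rw [hθ]; field_simp
      have hyT : ‖tang y‖ ≤ Real.sqrt c * σ := by
        have h1 : ‖tang y‖ ≤ ‖xh‖ + θ⁻¹ * (r + ‖xh‖) := by
          rw [hy, tang_add, tang_smul]
          refine (norm_add_le _ _).trans ?_
          rw [norm_smul, Real.norm_of_nonneg (by positivity)]
          gcongr
          · exact norm_tang_le _
          · exact (norm_tang_le _).trans (norm_sub_le _ _)
        have h2 : θ⁻¹ * (r + ‖xh‖) ≤ Real.sqrt c * σ / 2 := by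
          rw [inv_mul_le_iff₀ hθ0]
          linarith
        have h3 : ‖xh‖ ≤ Real.sqrt c * σ / 2 := by
          have : θ * (Real.sqrt c * σ) ≤ Real.sqrt c * σ :=
            mul_le_of_le_one_left (by positivity) hθ1.le
          linarith
        linarith
      have hym : y ∈ closure Ω := by
        refine (hreg Ω B h.toQuadraticDomain y (by rw [hyl]; exact hs0.le)
          (by rw [hyl]; linarith) ?_).1
        rw [hyl]
        calc ‖tang y‖ ^ 2 ≤ (Real.sqrt c * σ) ^ 2 := by gcongr
          _ = c * s := by rw [mul_pow, Real.sq_sqrt hc.le, hσ2]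
      have hvy := hlin Ω u b A B h g hg y hym
      rw [hyl] at hvy
      have hcomb : (1 - θ) • xh + θ • y = x := by
        rw [hy, smul_add, smul_smul, mul_inv_cancel₀ hθ0.ne']
        module
      have hconv := h.convexOn.2 hxhm hym (by linarith : 0 ≤ 1 - θ) hθ0.le (by ring)
      have hinner : inner ℝ g x = (1 - θ) * inner ℝ g xh + θ * inner ℝ g y := by
        rw [← hcomb, inner_add_right, inner_smul_right, inner_smul_right]
      rw [hcomb] at hconv
      simp only [smul_eq_mul] at hconv
      have h1 := mul_le_mul_of_nonneg_left hvy hθ0.le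
      have h2 := mul_le_mul_of_nonneg_left hvxh (by linarith : 0 ≤ 1 - θ)
      have h3 : (1 - θ) * (C₀ * (r * r ^ η)) ≤ C₀ * (r * r ^ η) :=
        mul_le_of_le_one_left (by positivity) (by linarith)
      rw [hinner]
      linarith
  have h1 := mul_le_mul_of_nonneg_left hθs hC₁.le
  have h2 : 0 ≤ C₁ / r₀ ^ η * (r * r ^ η) := by positivity
  linarith

end QuadraticProblem

lemma pointwiseCAt_one_of_le {Ω : Set (E (d + 1))} {u : E (d + 1) → ℝ} {g : E (d + 1)}
    {C δ : ℝ} (h0 : ∀ x ∈ closure Ω, 0 ≤ u x - u 0 - inner ℝ g x)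
    (h : ∀ x ∈ closure Ω, u x - u 0 - inner ℝ g x ≤ C * ‖x‖ ^ (1 + δ)) :
    PointwiseCAt 1 δ (closure Ω) u 0 := by
  refine ⟨MvPolynomial.C (u 0) + ∑ i, MvPolynomial.C (g i) * MvPolynomial.X i, ?_, ?_⟩
  · refine (MvPolynomial.totalDegree_add _ _).trans (max_le (by simp) ?_)
    refine MvPolynomial.totalDegree_finsetSum_le fun i _ => ?_
    refine (MvPolynomial.totalDegree_mul _ _).trans ?_
    simp
  · refine IsBigO.of_bound C ?_
    filter_upwards [self_mem_nhdsWithin] with x hx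
    have heval : MvPolynomial.eval (fun i => x i)
        (MvPolynomial.C (u 0) + ∑ i, MvPolynomial.C (g i) * MvPolynomial.X i)
        = u 0 + inner ℝ g x := by
      simp [PiLp.inner_apply, mul_comm]
    rw [heval, ← sub_sub, Real.norm_of_nonneg (h0 x hx),
      Real.norm_of_nonneg (by positivity), sub_zero]
    simpa using h x hx

end BoundaryMA

theorem theorem2p2 (d : ℕ) (α : ℝ) (hα : 0 < α) (hα1 : α ≤ 1) :
    ∃ δ₀ : ℝ, 0 < δ₀ ∧ δ₀ < 1 ∧
      ∀ lam Lam M κ K ρ : ℝ, 0 < lam → 0 < κ → 0 < ρ →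
        ∃ C : ℝ, 0 < C ∧
          ∀ (Ω : Set (E (d + 1))) (u f φ : E (d + 1) → ℝ)
            (cp cq : ℝ) (bp bq : E d) (Ap Aq : E d →L[ℝ] E d),
            -- the domain: open, convex, in the upper half space, uniformly convex at `0 ∈ ∂Ω`
            IsOpen Ω → Convex ℝ Ω → (∀ x ∈ Ω, 0 < lastCoord x) → (0 : E (d + 1)) ∈ frontier Ω →
            UniformlyConvexAt κ Ω 0 (eLast d) →
            -- `u` is a convex continuous solution of the Dirichlet problem
            ConvexOn ℝ (closure Ω) u → ContinuousOn u (closure Ω) →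
            AEMeasurable f (volume.restrict Ω) →
            (∀ᵐ x ∂(volume.restrict Ω), lam ≤ f x ∧ f x ≤ Lam) →
            IsAlexandrovSolution Ω u f →
            (∀ x ∈ frontier Ω, u x = φ x) →
            (∀ x ∈ frontier Ω, |φ x| ≤ K) →
            -- near `0`, `∂Ω` and `φ` agree with quadratic polynomials `q` and `p` of `x'`
            IsSelfAdjoint Ap → IsSelfAdjoint Aq →
            ‖bp‖ ≤ M → ‖Ap‖ ≤ M → ‖Aq‖ ≤ M →
            (∀ x ∈ frontier Ω, ‖x‖ < ρ →
              |lastCoord x - quadPoly cq bq Aq (tang x)| ≤ M * ‖tang x‖ ^ (2 + α)) →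
            (∀ x ∈ frontier Ω, ‖x‖ < ρ →
              |φ x - quadPoly cp bp Ap (tang x)| ≤ M * ‖tang x‖ ^ (2 + α)) →
            -- `∇u(0)` exists, the estimate holds with it, and `u` is pointwise `C^{1,δ₀}` at `0`
            (∃ g : E (d + 1), IsBoundaryGradient Ω u 0 (eLast d) g) ∧
            (∀ g : E (d + 1), IsBoundaryGradient Ω u 0 (eLast d) g →
              ∀ x ∈ closure Ω, u x - u 0 - inner ℝ g x ≤ C * ‖x‖ ^ (1 + δ₀)) ∧
            PointwiseCAt 1 δ₀ (closure Ω) u 0 := by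
  have hd0 : (0 : ℝ) ≤ d := Nat.cast_nonneg d
  refine ⟨α / (4 * ((d : ℝ) + 1)), by positivity, ?_, ?_⟩
  · rw [div_lt_one (by positivity)]
    linarith
  intro lam Lam M κ K ρ _ hκ hρ
  -- the estimates assume `1 ≤ M` and nonnegative bounds, hence `max M 1`, `|Lam|` and `|K|`
  have hM1 : 1 ≤ max M 1 := le_max_right _ _
  have hMM : M ≤ max M 1 := le_max_left _ _
  obtain ⟨C, hC, hest⟩ := QuadraticProblem.exists_sub_le_rpow (d := d) hα hα1 (abs_nonneg Lam)
    hM1 hκ (abs_nonneg K) hρ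
  refine ⟨C, hC, ?_⟩
  intro Ω u f φ cp cq bp bq Ap Aq hΩ hconv hpos h0 hunif hu huc _ hf hMA huφ hφK _ _ hbp hAp hAq
    hq hp
  have hexp : (2 + α) ≠ 0 := by positivity
  have hcq : cq = 0 := by
    have := hq 0 h0 (by simpa using hρ)
    simpa [quadPoly, Real.zero_rpow hexp] using this
  have hcp : cp = u 0 := by
    have := hp 0 h0 (by simpa using hρ)
    rw [huφ 0 h0]
    simp only [quadPoly, tang_zero, map_zero, inner_zero_right, norm_zero, Real.zero_rpow hexp,
      mul_zero, add_zero, abs_nonpos_iff] at this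
    linarith
  subst hcq hcp
  have hmono : ∀ x : E (d + 1), M * ‖tang x‖ ^ (2 + α) ≤ max M 1 * ‖tang x‖ ^ (2 + α) :=
    fun x => mul_le_mul_of_nonneg_right hMM (by positivity)
  have hbq : bq = 0 := linear_part_eq_zero hα hM1 hρ hΩ hconv hpos h0 (hAq.trans hMM)
    fun x hx hxρ => (hq x hx hxρ).trans (hmono x)
  subst hbq
  have hprob : QuadraticProblem α |Lam| (max M 1) κ |K| ρ Ω u bp Ap Aq :=
    { isOpen := hΩ
      convex := hconv
      zero_mem_frontier := h0
      lastCoord_pos := hpos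
      uniformlyConvex := hunif
      norm_le := hAq.trans hMM
      near := fun x hx hxρ => by
        have := (hq x hx hxρ).trans (hmono x)
        simpa [quadPoly] using this
      convexOn := hu
      continuousOn := huc
      volume_le := fun S hS hSm => by
        rw [hMA S hS hSm, ← setLIntegral_const]
        refine lintegral_mono_ae ?_
        filter_upwards [ae_restrict_of_ae_restrict_of_subset hS hf] with x hx
        exact ENNReal.ofReal_le_ofReal (hx.2.trans (le_abs_self _))
      abs_boundary_le := fun x hx => by
        rw [huφ x hx]
        exact (hφK x hx).trans (le_abs_self _)
      norm_linear_le := hbp.trans hMM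
      norm_hessian_le := hAp.trans hMM
      near_data := fun x hx hxρ => by
        rw [huφ x hx]
        exact (hp x hx hxρ).trans (hmono x) }
  obtain ⟨g, hg⟩ := hprob.exists_gradient hα (abs_nonneg _) hM1 hκ (abs_nonneg _) hρ
  exact ⟨⟨g, hg⟩, hest Ω u bp Ap Aq hprob,
    pointwiseCAt_one_of_le
      (fun x hx => QuadraticProblem.sub_nonneg_of_isBoundaryGradient hg hx)
      (hest Ω u bp Ap Aq hprob g hg)⟩
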